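/- Let $(M,[g])$ be a connected smooth manifold (without boundary) of dimension $d\ge 3$ with a conformal class of Riemannian metrics, and let $\mathcal T$ be its standard tractor bundle. A section of $\mathcal T$ is given in each scale $g\in[g]$ by a triple $(\sigma,\mu_a,\rho)$ of weights $1,1,-1$, and under $\hat g=e^{2\omega}g$, $\Upsilon=d\omega$, it transforms by $$\widehat{(\sigma,\mu_b,\rho)}=\bigl(\sigma,\ \mu_b+\sigma\Upsilon_b,\ \rho-\mathbf g^{bc}\Upsilon_b\mu_c-\tfrac12\sigma\,\mathbf g^{bc}\Upsilon_b\Upsilon_c\bigr).$$ Here $\mathbf g$ is the conformal metric. The tractor metric is $h:(\sigma,\mu,\rho)\mapsto \mathbf g^{-1}(\mu,\mu)+2\sigma\rho$, and the tractor connection is $$\nabla^{\mathcal T}_a(\sigma,\mu_b,\rho)=(\nabla_a\sigma-\mu_a,\ \nabla_a\mu_b+\mathbf g_{ab}\rho+P_{ab}\sigma,\ \nabla_a\rho-P_{ab}\mu^b),$$ where $P$ is the Schouten tensor, $\mathrm{Ric}=(d-2)P+Jg$, $J=\mathrm{tr}_g P$. Let $(M,[g],I)$ be a (directed) almost Einstein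 structure, i.e. $I\ne 0$ is a smooth section of $\mathcal T$ with $\nabla^{\mathcal T}I=0$. Write $\sigma$ for the first slot of $I$, $\Sigma=\{\sigma=0\}$, $|I|^2=h(I,I)$, and $$S(I)=\tfrac2d\,\sigma(J-\Delta)\sigma-|\nabla\sigma|^2_{\mathbf g},\qquad \Delta=-\nabla^a\nabla_a .$$ Then $|I|^2$ and $S(I)$ are constant on $M$, and there are three cases. * $|I|^2<0$, which is equivalent to $S(I)>0$: then $\Sigma$ is empty and $(M,\sigma^{-2}\mathbf g)$ is Einstein with positive scalar curvature. * $|I|^2=0$, which is equivalent to $S(I)=0$: then $\Sigma$ is empty or consists of isolated points, and $(M\setminus\Sigma,\sigma^{-2}\mathbf g)$ is Ricci-flat. * $|I|^2>0$, which is equivalent to $S(I)<0$: then $\Sigma$ is empty or is a totally umbilic (embedded, smooth) hypersurface, and $(M\setminus\Sigma,\sigma^{-2}\mathbf g)$ is Einstein with negative scalar curvature. In the non-empty case $|I|^{-1}I|_\Sigma=N$, where $|I|=\sqrt{|I|^2}$ and $N$ is the normal tractor of $\Sigma$: for a unit conormal $n_a$ of $\Sigma$ (weight $1$, $\mathbf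 g^{ab}n_an_b=1$ along $\Sigma$, one of the two choices of sign) it is $N=(0,n_a,-H^g)$ in each scale $g$, with mean curvature $H^g=\frac1{d-1}(\nabla_an^a-n^an^b\nabla_an_b)$. In particular $I|_\Sigma=N$ if $|I|^2=1$. -/

import Mathlib

open scoped Manifold ContDiff Topology
open Bundle Set Filter

noncomputable section

namespace AlmostEinstein

/-! ### Tensor calculus in coordinates

`M` is a smooth manifold without boundary modelled on `ℝ^d`.  A covariant tensor field is handled
through its components in the coordinate frame of the preferred chart around a base point `x₀`;
its value at `x` is read off in the chart around `x` itself. -/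

section Calculus

variable {d : ℕ} {M : Type*} [TopologicalSpace M] [ChartedSpace (EuclideanSpace ℝ (Fin d)) M]
  [IsManifold (𝓡 d) ∞ M]

/-- The coordinate vector `∂_i` at `z` of the chart around `x₀`
(the tangent bundle is trivialised over the chart domain by the derivative of the chart). -/
def frame (x₀ z : M) (i : Fin d) : TangentSpace (𝓡 d) z :=
  (trivializationAt (EuclideanSpace ℝ (Fin d)) (TangentSpace (𝓡 d) : M → Type _) x₀).symmL ℝ z
    (EuclideanSpace.single i (1 : ℝ))

/-- The partial derivative `∂_i f` in the chart around `x₀`, as a function on the chart domain. -/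
def pd (x₀ : M) (i : Fin d) (f : M → ℝ) (z : M) : ℝ :=
  fderiv ℝ (fun y => f ((extChartAt (𝓡 d) x₀).symm y)) (extChartAt (𝓡 d) x₀ z)
    (EuclideanSpace.single i (1 : ℝ))

variable (d M) in
/-- Fields of bilinear forms on the tangent spaces, with no regularity imposed. -/
abbrev BilinField := ∀ x : M, TangentSpace (𝓡 d) x →L[ℝ] TangentSpace (𝓡 d) x →L[ℝ] ℝ

variable (d M) in
/-- Fields of covectors, with no regularity imposed. -/
abbrev FormField := ∀ x : M, TangentSpace (𝓡 d) x →L[ℝ] ℝ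

/-- Components `g_{ij}` at `z` in the chart around `x₀`. -/
def coeff (g : BilinField d M) (x₀ z : M) : Matrix (Fin d) (Fin d) ℝ :=
  Matrix.of fun i j => g z (frame x₀ z i) (frame x₀ z j)

/-- Christoffel symbols
`Γ^k_{ij} = ½ g^{kl} (∂_i g_{jl} + ∂_j g_{il} - ∂_l g_{ij})` in the chart around `x₀`. -/
def christoffel (g : BilinField d M) (x₀ : M) (k i j : Fin d) (z : M) : ℝ :=
  (1 / 2 : ℝ) * ∑ l, (coeff g x₀ z)⁻¹ k l *
    (pd x₀ i (fun w => coeff g x₀ w j l) z + pd x₀ j (fun w => coeff g x₀ w i l) z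
      - pd x₀ l (fun w => coeff g x₀ w i j) z)

/-- The Ricci tensor at `x`, `R_{ij} = ∂_k Γ^k_{ij} - ∂_j Γ^k_{ik}
+ Γ^k_{kl} Γ^l_{ij} - Γ^k_{jl} Γ^l_{ik}`, in the chart around `x`
(positive on round spheres). -/
def ricci (g : BilinField d M) (x : M) (i j : Fin d) : ℝ :=
  ∑ k, (pd x k (christoffel g x k i j) x - pd x j (christoffel g x k i k) x
    + ∑ l, (christoffel g x k k l x * christoffel g x l i j x
      - christoffel g x k j l x * christoffel g x l i k x))

/-- The scalar curvature `g^{ij} R_{ij}`. -/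
def scalarCurv (g : BilinField d M) (x : M) : ℝ :=
  ∑ i, ∑ j, (coeff g x x)⁻¹ i j * ricci g x i j

/-- `J`, the metric trace of the Schouten tensor: `Sc = 2 (d - 1) J`. -/
def traceJ (g : BilinField d M) (x : M) : ℝ :=
  scalarCurv g x / (2 * ((d : ℝ) - 1))

/-- The Schouten tensor `P`, determined by `Ric = (d - 2) P + J g`. -/
def schouten (g : BilinField d M) (x : M) (i j : Fin d) : ℝ :=
  (ricci g x i j - traceJ g x * coeff g x x i j) / ((d : ℝ) - 2)

/-- The Levi-Civita derivative `∇_i α_j = ∂_i α_j - Γ^k_{ij} α_k` at `x`, in the chart around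
`x`. -/
def nablaForm (g : BilinField d M) (α : FormField d M) (x : M) (i j : Fin d) : ℝ :=
  pd x i (fun w => α w (frame x w j)) x
    - ∑ k, christoffel g x k i j x * α x (frame x x k)

/-- The differential of a function. -/
def dform (f : M → ℝ) : FormField d M := fun x => mvfderiv (𝓡 d) f x

/-- The inner product `g^{ij} α_i β_j` of covectors at `x`. -/
def coInner (g : BilinField d M) (x : M) (α β : TangentSpace (𝓡 d) x →L[ℝ] ℝ) : ℝ :=
  ∑ i, ∑ j, (coeff g x x)⁻¹ i j * (α (frame x x i) * β (frame x x j))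

/-- `S(g,s) = (2/d) s (J - Δ) s - |ds|²`, where `Δ = -∇^i ∇_i` is the positive Laplacian. -/
def scaleCurv (g : BilinField d M) (s : M → ℝ) (x : M) : ℝ :=
  2 / (d : ℝ) * s x *
      (traceJ g x * s x + ∑ i, ∑ j, (coeff g x x)⁻¹ i j * nablaForm g (dform s) x i j)
    - coInner g x (dform s x) (dform s x)

/-- `g` is an Einstein metric on the open set `U`: `Ric = c g` there, for a constant `c`.
Only the values of `g` on `U` matter. -/
def IsEinsteinOn (g : BilinField d M) (U : Set M) : Prop :=
  ∃ c : ℝ, ∀ x ∈ U, ∀ i j, ricci g x i j = c * coeff g x x i j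

/-- `g` is Ricci-flat on the open set `U`. -/
def IsRicciFlatOn (g : BilinField d M) (U : Set M) : Prop :=
  ∀ x ∈ U, ∀ i j, ricci g x i j = 0

/-- Smoothness of a field of covectors at a point, as a section of the cotangent bundle. -/
def SmoothFormAt (α : FormField d M) (x : M) : Prop :=
  ContMDiffAt (𝓡 d) ((𝓡 d).prod 𝓘(ℝ, EuclideanSpace ℝ (Fin d) →L[ℝ] ℝ)) ∞
    (fun y => TotalSpace.mk' (EuclideanSpace ℝ (Fin d) →L[ℝ] ℝ)
      (E := fun y : M => TangentSpace (𝓡 d) y →L[ℝ] ℝ) y (α y)) x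

end Calculus

/-! ### Conformal structures and the standard tractor bundle -/

section Conformal

variable (d : ℕ) (M : Type*) [TopologicalSpace M] [ChartedSpace (EuclideanSpace ℝ (Fin d)) M]
  [IsManifold (𝓡 d) ∞ M]

/-- Smooth Riemannian metrics on `M`. -/
abbrev SmoothMetric :=
  ContMDiffRiemannianMetric (𝓡 d) ∞ (EuclideanSpace ℝ (Fin d)) (TangentSpace (𝓡 d) : M → Type _)

variable {d M}

/-- `g' = e^{2φ} g` for the smooth function `φ`. -/
def IsRescaling (g g' : SmoothMetric d M) (φ : M → ℝ) : Prop :=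
  ContMDiff (𝓡 d) 𝓘(ℝ, ℝ) ∞ φ ∧
    ∀ (x : M) (u v : TangentSpace (𝓡 d) x),
      g'.inner x u v = Real.exp (2 * φ x) * g.inner x u v

variable (d M)

/-- Conformal equivalence of metrics. -/
instance conformalSetoid : Setoid (SmoothMetric d M) where
  r g g' := ∃ φ, IsRescaling g g' φ
  iseqv := by
    refine ⟨fun g => ⟨fun _ => 0, contMDiff_const, by simp⟩, ?_, ?_⟩
    · rintro g g' ⟨φ, h, e⟩
      refine ⟨fun x => - φ x, h.neg, fun x u v => ?_⟩
      rw [e, ← mul_assoc, ← Real.exp_add]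
      simp
    · rintro g g' g'' ⟨φ, h, e⟩ ⟨φ', h', e'⟩
      refine ⟨fun x => φ' x + φ x, h'.add h, fun x u v => ?_⟩
      rw [e', e, ← mul_assoc, ← Real.exp_add, mul_add]

/-- A conformal structure `[g]` on `M`. -/
def ConformalStructure := Quotient (conformalSetoid d M)

variable {d M}

/-- The metrics in the conformal class. -/
def ConformalStructure.Metric (c : ConformalStructure d M) :=
  {g : SmoothMetric d M // (Quotient.mk (conformalSetoid d M) g) = c}

/-- The bilinear form field underlying a metric of the class. -/
abbrev ConformalStructure.Metric.field {c : ConformalStructure d M} (g : c.Metric) :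
    BilinField d M := fun x => g.1.inner x

lemma coeff_rescale {g g' : SmoothMetric d M} {φ : M → ℝ} (h : IsRescaling g g' φ) (x : M) :
    coeff g'.inner x x = Real.exp (2 * φ x) • coeff g.inner x x := by
  ext i j
  simp [coeff, h.2]

lemma inv_smul_matrix (k : ℝ) (hk : k ≠ 0) (A : Matrix (Fin d) (Fin d) ℝ) :
    (k • A)⁻¹ = k⁻¹ • A⁻¹ := by
  by_cases hA : IsUnit A.det
  · exact Matrix.inv_smul' A (Units.mk0 k hk) hA
  · have : ¬ IsUnit (k • A).det := by
      rw [Matrix.det_smul, IsUnit.mul_iff]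
      exact fun h => hA h.2
    rw [Matrix.nonsing_inv_apply_not_isUnit _ hA, Matrix.nonsing_inv_apply_not_isUnit _ this,
      smul_zero]

lemma coInner_rescale {g g' : SmoothMetric d M} {φ : M → ℝ} (h : IsRescaling g g' φ) (x : M)
    (α β : TangentSpace (𝓡 d) x →L[ℝ] ℝ) :
    coInner g'.inner x α β = (Real.exp (2 * φ x))⁻¹ * coInner g.inner x α β := by
  simp only [coInner, coeff_rescale h, inv_smul_matrix _ (Real.exp_ne_zero _), Finset.mul_sum,
    Matrix.smul_apply, smul_eq_mul, mul_assoc]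

lemma coInner_comm (g : SmoothMetric d M) (x : M) (α β : TangentSpace (𝓡 d) x →L[ℝ] ℝ) :
    coInner g.inner x α β = coInner g.inner x β α := by
  have hs : (coeff g.inner x x)⁻¹.transpose = (coeff g.inner x x)⁻¹ := by
    rw [Matrix.transpose_nonsing_inv]
    congr 1
    ext i j
    simp [coeff, g.symm x]
  unfold coInner
  rw [Finset.sum_comm]
  refine Finset.sum_congr rfl fun i _ => Finset.sum_congr rfl fun j _ => ?_
  conv_lhs => rw [← hs]
  rw [Matrix.transpose_apply]
  ring

lemma coInner_add_right (g : BilinField d M) (x : M) (α β γ : TangentSpace (𝓡 d) x →L[ℝ] ℝ) :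
    coInner g x α (β + γ) = coInner g x α β + coInner g x α γ := by
  simp only [coInner, add_apply, mul_add, Finset.sum_add_distrib]

lemma coInner_smul_right (g : BilinField d M) (x : M) (a : ℝ)
    (α β : TangentSpace (𝓡 d) x →L[ℝ] ℝ) :
    coInner g x α (a • β) = a * coInner g x α β := by
  simp only [coInner, smul_apply, smul_eq_mul, Finset.mul_sum]
  refine Finset.sum_congr rfl fun i _ => Finset.sum_congr rfl fun j _ => ?_
  ring

variable (d) in
/-- Triples `(σ, μ, ρ)` at a point: the components of a tractor in a scale `g`.  The weights are
trivialised by `g`, so `σ` and `ρ` are numbers and `μ` is a covector. -/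
abbrev Triple (x : M) := ℝ × (TangentSpace (𝓡 d) x →L[ℝ] ℝ) × ℝ

/-- The change of components under `g' = e^{2φ} g`, with `Υ = dφ`:
`(σ, μ, ρ) ↦ (σ, μ + σ Υ, ρ - g⁻¹(Υ, μ) - ½ σ g⁻¹(Υ, Υ))`.  The factors `e^{φ}, e^{φ}, e^{-φ}`
account for the conformal weights `1, 1, -1` of the three slots. -/
def changeScale (g : SmoothMetric d M) (φ : M → ℝ) (x : M) (t : Triple d x) : Triple d x :=
  (Real.exp (φ x) * t.1,
   Real.exp (φ x) • (t.2.1 + t.1 • dform φ x),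
   Real.exp (-φ x) * (t.2.2 - coInner g.inner x (dform φ x) t.2.1
      - (1 / 2 : ℝ) * t.1 * coInner g.inner x (dform φ x) (dform φ x)))

/-- The fibre at `x` of the standard tractor bundle of the conformal structure `c`: a tractor has
components `(σ, μ, ρ)` in each scale `g ∈ c`, and those in different scales are related by the
transformation formula. -/
def Tractor (c : ConformalStructure d M) (x : M) : Submodule ℝ (c.Metric → Triple d x) where
  carrier := {t | ∀ (g g' : c.Metric) (φ : M → ℝ), IsRescaling g.1 g'.1 φ →
    t g' = changeScale g.1 φ x (t g)}
  add_mem' := by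
    intro s t hs ht g g' φ h
    simp only [Pi.add_apply, hs g g' φ h, ht g g' φ h, changeScale, Prod.fst_add, Prod.snd_add,
      coInner_add_right, Prod.mk_add_mk, Prod.mk.injEq]
    refine ⟨by ring, by module, by ring⟩
  zero_mem' := by
    intro g g' φ h
    have h0 : coInner g.1.inner x (dform φ x) 0 = 0 := by simp [coInner]
    simp [changeScale, h0]
    rfl
  smul_mem' := by
    intro a t ht g g' φ h
    simp only [Pi.smul_apply, ht g g' φ h, changeScale, Prod.smul_fst, Prod.smul_snd,
      coInner_smul_right, Prod.smul_mk, smul_eq_mul, Prod.mk.injEq]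
    refine ⟨by ring, by module, by ring⟩

variable {c : ConformalStructure d M} {x : M}

/-- A metric of the class. -/
def ConformalStructure.someMetric (c : ConformalStructure d M) : c.Metric :=
  ⟨Quotient.out c, Quotient.out_eq c⟩

/-- The quadratic form `g⁻¹(μ, μ) + 2 σ ρ`, polarised, in the scale `g`. -/
def formIn (g : SmoothMetric d M) (s t : Triple d x) : ℝ :=
  coInner g.inner x s.2.1 t.2.1 + s.1 * t.2.2 + s.2.2 * t.1

/-- The tractor metric `h`; it does not depend on the scale (`tractorMetric_eq`). -/
def tractorMetric (s t : Tractor c x) : ℝ :=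
  formIn c.someMetric.1 (s.1 c.someMetric) (t.1 c.someMetric)

lemma tractorMetric_eq (s t : Tractor c x) (g : c.Metric) :
    tractorMetric s t = formIn g.1 (s.1 g) (t.1 g) := by
  obtain ⟨φ, h⟩ : ∃ φ, IsRescaling g.1 c.someMetric.1 φ :=
    Quotient.exact (s := conformalSetoid d M) (g.2.trans c.someMetric.2.symm)
  unfold tractorMetric formIn
  rw [s.2 g _ φ h, t.2 g _ φ h]
  simp only [changeScale, coInner_rescale h, coInner_smul_right, coInner_add_right]
  rw [coInner_comm _ _ (Real.exp (φ x) • _) (t.1 g).2.1,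
    coInner_comm _ _ (Real.exp (φ x) • _) (dform φ x)]
  simp only [coInner_smul_right, coInner_add_right]
  rw [coInner_comm _ _ (t.1 g).2.1 (s.1 g).2.1, coInner_comm _ _ (t.1 g).2.1 (dform φ x)]
  have e1 : (Real.exp (2 * φ x))⁻¹ * (Real.exp (φ x) * Real.exp (φ x)) = 1 := by
    rw [← Real.exp_add, ← Real.exp_neg, ← Real.exp_add]
    simp [two_mul]
  have e2 : Real.exp (φ x) * Real.exp (-φ x) = 1 := by
    rw [← Real.exp_add]
    simp
  generalize (Real.exp (2 * φ x))⁻¹ = A at *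
  generalize Real.exp (φ x) = B at *
  generalize Real.exp (-φ x) = C at *
  linear_combination
    (coInner g.1.inner x (s.1 g).2.1 (t.1 g).2.1
      + (t.1 g).1 * coInner g.1.inner x (dform φ x) (s.1 g).2.1
      + (s.1 g).1 * coInner g.1.inner x (dform φ x) (t.1 g).2.1
      + (s.1 g).1 * (t.1 g).1 * coInner g.1.inner x (dform φ x) (dform φ x)) * e1
    + ((s.1 g).1 * ((t.1 g).2.2 - coInner g.1.inner x (dform φ x) (t.1 g).2.1
        - (1 / 2 : ℝ) * (t.1 g).1 * coInner g.1.inner x (dform φ x) (dform φ x))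
      + (t.1 g).1 * ((s.1 g).2.2 - coInner g.1.inner x (dform φ x) (s.1 g).2.1
        - (1 / 2 : ℝ) * (s.1 g).1 * coInner g.1.inner x (dform φ x) (dform φ x))) * e2

/-- Sections of the standard tractor bundle (no regularity imposed). -/
abbrev TractorField (c : ConformalStructure d M) := ∀ x : M, Tractor c x

namespace TractorField

variable (I : TractorField c) (g : c.Metric)

/-- The first slot in the scale `g`, i.e. the density `σ = h(X, I)` of weight 1 (where `X` is the
canonical tractor `(0, 0, 1)`), trivialised by `g`. -/
def sig : M → ℝ := fun x => ((I x).1 g).1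

/-- The middle slot in the scale `g`. -/
def mu : FormField d M := fun x => ((I x).1 g).2.1

/-- The last slot in the scale `g`. -/
def rho : M → ℝ := fun x => ((I x).1 g).2.2

/-- Smoothness of a section: its components are smooth in every scale. -/
def IsSmooth (I : TractorField c) : Prop :=
  ∀ g : c.Metric, ContMDiff (𝓡 d) 𝓘(ℝ, ℝ) ∞ (I.sig g) ∧ (∀ x, SmoothFormAt (I.mu g) x) ∧
    ContMDiff (𝓡 d) 𝓘(ℝ, ℝ) ∞ (I.rho g)

/-- The components, in the scale `g` and in the chart around `x`, of the tractor connection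
`∇_a (σ, μ_b, ρ) = (∇_a σ - μ_a, ∇_a μ_b + g_{ab} ρ + P_{ab} σ, ∇_a ρ - P_{ab} μ^b)`. -/
def connection (x : M) (a : Fin d) : ℝ × (Fin d → ℝ) × ℝ :=
  (pd x a (I.sig g) x - I.mu g x (frame x x a),
   fun b => nablaForm g.field (I.mu g) x a b + coeff g.field x x a b * I.rho g x
      + schouten g.field x a b * I.sig g x,
   pd x a (I.rho g) x - ∑ b, ∑ e, schouten g.field x a b *
      ((coeff g.field x x)⁻¹ b e * I.mu g x (frame x x e)))

/-- `I` is parallel for the tractor connection.  (The connection is conformally invariant, so the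
condition is the same for all scales `g`.) -/
def IsParallel (I : TractorField c) : Prop :=
  ∀ (g : c.Metric) (x : M) (a : Fin d), I.connection g x a = 0

/-- The scale singularity set `Σ`, the zero set of the density `σ = h(X, I)`. -/
def singularSet (I : TractorField c) : Set M := {x | ∀ g : c.Metric, I.sig g x = 0}

/-- The metric `σ⁻² 𝐠` (meaningful off `Σ`), written in a scale `g` as `s⁻² g`;
it is the same for all `g` in the class. -/
def singularMetric : BilinField d M := fun x => ((I.sig g x) ^ 2)⁻¹ • g.1.inner x

end TractorField

/-- An almost Einstein structure `(M, [g], I)`: a (smooth) parallel section `I ≠ 0` of the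
standard tractor bundle of the conformal structure. -/
structure IsAlmostEinstein (I : TractorField c) : Prop where
  smooth : I.IsSmooth
  parallel : I.IsParallel
  ne_zero : ∃ x, I x ≠ 0

end Conformal

/-! ### Hypersurfaces -/

section Hypersurface

variable {d : ℕ} {M : Type*} [TopologicalSpace M] [ChartedSpace (EuclideanSpace ℝ (Fin d)) M]
  [IsManifold (𝓡 d) ∞ M]

variable (d) in
/-- `S` is an embedded smooth hypersurface: around each of its points there is a smooth chart of
`M` in which `S` is the zero set of one of the coordinates. -/
def IsHypersurface (S : Set M) : Prop :=
  ∀ p ∈ S, ∃ e ∈ IsManifold.maximalAtlas (𝓡 d) ∞ M, p ∈ e.source ∧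
    ∃ i : Fin d, ∀ q ∈ e.source, q ∈ S ↔ e q i = 0

/-- The tangent space of `S` at `p`: velocities of smooth curves that run in `S`, given by their
components in the chart around `p`. -/
def tangentVectors (S : Set M) (p : M) : Set (EuclideanSpace ℝ (Fin d)) :=
  {v | ∃ γ : ℝ → M, ContMDiffAt 𝓘(ℝ, ℝ) (𝓡 d) ∞ γ 0 ∧ γ 0 = p ∧ (∀ᶠ t in 𝓝 (0 : ℝ), γ t ∈ S) ∧
    HasDerivAt (fun t => extChartAt (𝓡 d) p (γ t)) v 0}

/-- Near `p`, the smooth 1-form `ν` restricts along `S` to a conormal of `S` of unit length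
for `g`. -/
def IsUnitConormalNear (g : BilinField d M) (S : Set M) (ν : FormField d M) (p : M) : Prop :=
  (∀ᶠ q in 𝓝 p, SmoothFormAt ν q) ∧
  ∀ᶠ q in 𝓝 p, q ∈ S → coInner g q (ν q) (ν q) = 1 ∧
    ∀ v ∈ tangentVectors S q, ∑ i, v i * ν q (frame q q i) = 0

/-- `ν^i = g^{ij} ν_j`. -/
def raise (g : BilinField d M) (ν : FormField d M) (x : M) (i : Fin d) : ℝ :=
  ∑ j, (coeff g x x)⁻¹ i j * ν x (frame x x j)

/-- The mean curvature `H = (∇_a ν^a - ν^a ν^b ∇_a ν_b) / (d - 1)` with respect to the unit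
conormal `ν`; it only depends on `ν` along the hypersurface. -/
def meanCurv (g : BilinField d M) (ν : FormField d M) (x : M) : ℝ :=
  (∑ a, ∑ b, ((coeff g x x)⁻¹ a b - raise g ν x a * raise g ν x b) * nablaForm g ν x a b)
    / ((d : ℝ) - 1)

/-- The second fundamental form `L(u, v) = u^a v^b ∇_a ν_b`, for `u, v` tangent to the
hypersurface. -/
def secondFF (g : BilinField d M) (ν : FormField d M) (x : M)
    (u v : EuclideanSpace ℝ (Fin d)) : ℝ :=
  ∑ a, ∑ b, u a * v b * nablaForm g ν x a b

/-- `S` is a totally umbilic hypersurface for `g`: at each point the trace-free part of its second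
fundamental form (with respect to a local unit conormal, which is unique up to sign) vanishes. -/
def IsTotallyUmbilic (g : BilinField d M) (S : Set M) : Prop :=
  IsHypersurface d S ∧ ∀ p ∈ S, ∃ ν : FormField d M, IsUnitConormalNear g S ν p ∧
    ∀ u ∈ tangentVectors S p, ∀ v ∈ tangentVectors S p,
      secondFF g ν p u v = meanCurv g ν p * ∑ a, ∑ b, u a * v b * coeff g p p a b

/-- Along the hypersurface `S` the tractor field `N` is the normal tractor, `(0, ν_a, -H^g)` in
each scale `g`, for a smooth unit conormal `ν` of `S`. -/
def IsNormalTractorAlong {c : ConformalStructure d M} (N : TractorField c) (S : Set M) : Prop :=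
  ∀ (g : c.Metric), ∀ p ∈ S, ∃ ν : FormField d M, IsUnitConormalNear g.field S ν p ∧
    ∀ᶠ q in 𝓝 p, q ∈ S → (N q).1 g = (0, ν q, - meanCurv g.field ν q)

end Hypersurface

end AlmostEinstein

end

/-! In a fixed scale, parallelism says that `μ = dσ`, `Hess σ + ρ g + σ P = 0` and `dρ = P(μ, ·)`.
Differentiating `|dσ|² + 2σρ` with these equations gives zero, so `|I|²` is constant on the
connected manifold. The trace of the Hessian equation is `∇^a∇_a σ = -dρ - Jσ`, whence `S(I) =
-|I|²`, and the three equivalences are a change of sign. Where `σ ≠ 0`, inserting the Hessian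
equation in the conformal change of Ricci cancels the Schouten terms and leaves `Ric(σ⁻²g) =
-(d-1)|I|² σ⁻²g`.

On `Σ` one has `|I|² = |μ|²`. Hence `Σ` is empty if `|I|² < 0`. If `|I|² = 0`, then `dσ` vanishes on
`Σ`; a parallel section that is not identically zero has no zeros, so `ρ ≠ 0` on `Σ`, the Hessian
`-ρ g` is nondegenerate there, and `dσ` has no other zero nearby. If `|I|² > 0`, then `dσ ≠ 0` on
`Σ`, which is a regular level set with unit conormal `ν = μ/|I|`. Along it `∇ν = -(ρ/|I|) g` is pure
trace, which gives both umbilicity and `H = -ρ/|I|`, that is `I/|I| = (0, ν, -H)`.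

Each tensor is defined at `x` through the chart around `x` itself, so parallelism only gives
equations at the centre of each chart, whereas the argument differentiates them in one chart. Hence
the coordinate work: Christoffel symbols, Ricci tensor and Hessian are shown to transform correctly
under transition maps. The load is carried by `MetricOn.ricc_rescale`, `IsPullback.ricc_eq`,
`IsPullback.hess_eq`, `ParallelAt.cpd_norm`, `ParallelAt.ricc_rescale`,
`ParallelAt.eventually_eq_zero` and `ParallelAt.eventually_cpd_ne`. -/

noncomputable section

namespace AlmostEinstein

/-! ### Partial derivatives, Christoffel symbols and metric compatibility on `ℝ^d`. -/

section Coordinates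

variable {d : ℕ}

/-- The model space. -/
abbrev Eu (d : ℕ) := EuclideanSpace ℝ (Fin d)

/-- The coordinate vector `∂_i`. -/
abbrev ev (i : Fin d) : Eu d := EuclideanSpace.single i (1 : ℝ)

/-- Partial derivatives on the model space. -/
def cpd (i : Fin d) (f : Eu d → ℝ) (y : Eu d) : ℝ := fderiv ℝ f y (ev i)

lemma cpd_congr {f g : Eu d → ℝ} {y : Eu d} (h : f =ᶠ[𝓝 y] g) (i : Fin d) :
    cpd i f y = cpd i g y := by
  rw [cpd, cpd, h.fderiv_eq]

lemma cpd_congr_on {U : Set (Eu d)} (hU : IsOpen U) {f g : Eu d → ℝ} (h : ∀ y ∈ U, f y = g y)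
    {y : Eu d} (hy : y ∈ U) (i : Fin d) : cpd i f y = cpd i g y :=
  cpd_congr (eventually_of_mem (hU.mem_nhds hy) h) i

lemma cpd_const (i : Fin d) (a : ℝ) (y : Eu d) : cpd i (fun _ => a) y = 0 := by
  simp [cpd]

lemma cpd_smooth {f : Eu d → ℝ} {y : Eu d} (hf : ContDiffAt ℝ ∞ f y) (i : Fin d) :
    ContDiffAt ℝ ∞ (cpd i f) y :=
  (hf.fderiv_right (m := ∞) (by simp)).clm_apply contDiffAt_const

lemma smooth_differentiableAt {F : Type*} [NormedAddCommGroup F] [NormedSpace ℝ F]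
    {f : Eu d → F} {y : Eu d} (hf : ContDiffAt ℝ ∞ f y) :
    DifferentiableAt ℝ f y := hf.differentiableAt (by simp)

lemma cpd_add {f g : Eu d → ℝ} {y : Eu d} (hf : ContDiffAt ℝ ∞ f y) (hg : ContDiffAt ℝ ∞ g y)
    (i : Fin d) : cpd i (fun w => f w + g w) y = cpd i f y + cpd i g y := by
  simp [cpd, fderiv_fun_add (smooth_differentiableAt hf) (smooth_differentiableAt hg)]

lemma cpd_neg (f : Eu d → ℝ) (y : Eu d) (i : Fin d) :
    cpd i (fun w => - f w) y = - cpd i f y := by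
  simp [cpd, fderiv_fun_neg]

lemma cpd_sub {f g : Eu d → ℝ} {y : Eu d} (hf : ContDiffAt ℝ ∞ f y) (hg : ContDiffAt ℝ ∞ g y)
    (i : Fin d) : cpd i (fun w => f w - g w) y = cpd i f y - cpd i g y := by
  simp [cpd, fderiv_fun_sub (smooth_differentiableAt hf) (smooth_differentiableAt hg)]

lemma cpd_mul {f g : Eu d → ℝ} {y : Eu d} (hf : ContDiffAt ℝ ∞ f y) (hg : ContDiffAt ℝ ∞ g y)
    (i : Fin d) : cpd i (fun w => f w * g w) y = cpd i f y * g y + f y * cpd i g y := by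
  simp [cpd, fderiv_fun_mul (smooth_differentiableAt hf) (smooth_differentiableAt hg)]
  ring

lemma cpd_sum {ι : Type*} (s : Finset ι) {f : ι → Eu d → ℝ} {y : Eu d}
    (hf : ∀ a, ContDiffAt ℝ ∞ (f a) y) (i : Fin d) :
    cpd i (fun w => ∑ a ∈ s, f a w) y = ∑ a ∈ s, cpd i (f a) y := by
  simp [cpd, fderiv_fun_sum (fun a _ => smooth_differentiableAt (hf a))]

lemma cpd_comm {f : Eu d → ℝ} {y : Eu d} (hf : ContDiffAt ℝ ∞ f y) (i j : Fin d) :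
    cpd i (cpd j f) y = cpd j (cpd i f) y := by
  have hs : IsSymmSndFDerivAt ℝ f y := hf.isSymmSndFDerivAt (by simpa using ENat.LEInfty.out)
  have hd : DifferentiableAt ℝ (fderiv ℝ f) y :=
    smooth_differentiableAt (hf.fderiv_right (m := ∞) (by simp))
  have key : ∀ a b : Fin d, cpd a (cpd b f) y = fderiv ℝ (fderiv ℝ f) y (ev a) (ev b) := by
    intro a b
    have : cpd b f = fun w => fderiv ℝ f w (ev b) := rfl
    rw [cpd, this, fderiv_clm_apply hd (differentiableAt_const _)]
    simp
  rw [key, key, hs]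

/-- The Christoffel symbols of a matrix-valued function. -/
def chr (G : Eu d → Matrix (Fin d) (Fin d) ℝ) (k i j : Fin d) (y : Eu d) : ℝ :=
  (1 / 2 : ℝ) * ∑ l, (G y)⁻¹ k l *
    (cpd i (fun w => G w j l) y + cpd j (fun w => G w i l) y - cpd l (fun w => G w i j) y)

/-- The Ricci tensor of a matrix-valued function. -/
def ricc (G : Eu d → Matrix (Fin d) (Fin d) ℝ) (i j : Fin d) (y : Eu d) : ℝ :=
  ∑ k, (cpd k (chr G k i j) y - cpd j (chr G k i k) y
    + ∑ l, (chr G k k l y * chr G l i j y - chr G k j l y * chr G l i k y))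

/-- A smooth field of nondegenerate symmetric matrices on an open set. -/
structure MetricOn (G : Eu d → Matrix (Fin d) (Fin d) ℝ) (U : Set (Eu d)) : Prop where
  isOpen : IsOpen U
  smooth : ∀ y ∈ U, ∀ i j, ContDiffAt ℝ ∞ (fun w => G w i j) y
  symm : ∀ y i j, G y i j = G y j i
  det_ne : ∀ y ∈ U, (G y).det ≠ 0

lemma contDiffAt_det {m : Type*} [Fintype m] [DecidableEq m] {A : Eu d → Matrix m m ℝ} {y : Eu d}
    (hA : ∀ i j, ContDiffAt ℝ ∞ (fun w => A w i j) y) :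
    ContDiffAt ℝ ∞ (fun w => (A w).det) y := by
  simp only [Matrix.det_apply']
  exact ContDiffAt.sum fun σ _ => contDiffAt_const.mul (contDiffAt_prod fun i _ => hA _ _)

/-- Cramer's rule: the entries of the adjugate are themselves determinants, of matrices with one row
replaced by a constant one. -/
lemma contDiffAt_inv_entry {m : Type*} [Fintype m] [DecidableEq m] {A : Eu d → Matrix m m ℝ}
    {y : Eu d} (hA : ∀ i j, ContDiffAt ℝ ∞ (fun w => A w i j) y) (hd : (A y).det ≠ 0) (i j : m) :
    ContDiffAt ℝ ∞ (fun w => (A w)⁻¹ i j) y := by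
  simp only [Matrix.inv_def, Matrix.smul_apply, smul_eq_mul, Ring.inverse_eq_inv',
    Matrix.adjugate_apply]
  refine ((contDiffAt_det hA).inv hd).mul (contDiffAt_det fun a b => ?_)
  by_cases h : a = j
  · subst h
    simpa using contDiffAt_const
  · simpa [Matrix.updateRow_apply, h] using hA a b

variable {G : Eu d → Matrix (Fin d) (Fin d) ℝ} {U : Set (Eu d)}

namespace MetricOn

variable (hG : MetricOn G U) {y : Eu d} (hy : y ∈ U)
include hG

lemma mono {V : Set (Eu d)} (hV : IsOpen V) (h : V ⊆ U) : MetricOn G V :=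
  ⟨hV, fun y hy => hG.smooth y (h hy), hG.symm, fun y hy => hG.det_ne y (h hy)⟩

lemma chr_symm (k i j : Fin d) (y : Eu d) : chr G k i j y = chr G k j i y := by
  have : (fun w => G w i j) = fun w => G w j i := funext fun w => hG.symm w i j
  simp only [chr, this]
  congr 1
  exact Finset.sum_congr rfl fun l _ => by ring

lemma transpose_eq (y : Eu d) : (G y).transpose = G y := by
  ext i j
  exact hG.symm y j i

lemma inv_symm (y : Eu d) (i j : Fin d) : (G y)⁻¹ i j = (G y)⁻¹ j i := by
  have : ((G y)⁻¹).transpose = (G y)⁻¹ := by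
    rw [Matrix.transpose_nonsing_inv, hG.transpose_eq]
  conv_lhs => rw [← this]
  rfl

include hy

lemma smooth_inv (i j : Fin d) : ContDiffAt ℝ ∞ (fun w => (G w)⁻¹ i j) y :=
  contDiffAt_inv_entry (hG.smooth y hy) (hG.det_ne y hy) i j

lemma smooth_chr (k i j : Fin d) : ContDiffAt ℝ ∞ (chr G k i j) y := by
  unfold chr
  refine contDiffAt_const.mul (ContDiffAt.sum fun l _ => (hG.smooth_inv hy k l).mul ?_)
  exact ((cpd_smooth (hG.smooth y hy j l) i).add (cpd_smooth (hG.smooth y hy i l) j)).sub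
    (cpd_smooth (hG.smooth y hy i j) l)

lemma smooth_ricc (i j : Fin d) : ContDiffAt ℝ ∞ (ricc G i j) y := by
  unfold ricc
  refine ContDiffAt.sum fun k _ => ?_
  refine ((cpd_smooth (hG.smooth_chr hy k i j) k).sub
    (cpd_smooth (hG.smooth_chr hy k i k) j)).add (ContDiffAt.sum fun l _ => ?_)
  exact ((hG.smooth_chr hy _ _ _).mul (hG.smooth_chr hy _ _ _)).sub
    ((hG.smooth_chr hy _ _ _).mul (hG.smooth_chr hy _ _ _))

lemma mul_inv : G y * (G y)⁻¹ = 1 :=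
  Matrix.mul_nonsing_inv _ (isUnit_iff_ne_zero.2 (hG.det_ne y hy))

lemma inv_mul : (G y)⁻¹ * G y = 1 :=
  Matrix.nonsing_inv_mul _ (isUnit_iff_ne_zero.2 (hG.det_ne y hy))

lemma sum_mul_inv (i j : Fin d) : ∑ l, G y i l * (G y)⁻¹ l j = if i = j then 1 else 0 := by
  rw [← Matrix.mul_apply, hG.mul_inv hy, Matrix.one_apply]

lemma sum_inv_mul (i j : Fin d) : ∑ l, (G y)⁻¹ i l * G y l j = if i = j then 1 else 0 := by
  rw [← Matrix.mul_apply, hG.inv_mul hy, Matrix.one_apply]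

/-- Christoffel symbols of the first kind. -/
lemma sum_mul_chr (m i j : Fin d) :
    ∑ l, G y m l * chr G l i j y = (1 / 2 : ℝ) * (cpd i (fun w => G w j m) y
      + cpd j (fun w => G w i m) y - cpd m (fun w => G w i j) y) := by
  have e : ∀ l, G y m l * chr G l i j y = ∑ n, (1 / 2 : ℝ) * (G y m l * (G y)⁻¹ l n *
      (cpd i (fun w => G w j n) y + cpd j (fun w => G w i n) y - cpd n (fun w => G w i j) y)) := by
    intro l
    simp only [chr, Finset.mul_sum]
    exact Finset.sum_congr rfl fun n _ => by ring
  simp only [e]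
  rw [Finset.sum_comm]
  simp only [← Finset.mul_sum, ← Finset.sum_mul, hG.sum_mul_inv hy]
  simp

/-- The Levi-Civita connection is metric. -/
lemma cpd_metric (k i j : Fin d) : cpd k (fun w => G w i j) y
    = ∑ l, G y i l * chr G l k j y + ∑ l, G y j l * chr G l k i y := by
  rw [hG.sum_mul_chr hy, hG.sum_mul_chr hy]
  have h : ∀ a b, (fun w => G w a b) = fun w => G w b a := fun a b => funext fun w => hG.symm w a b
  rw [h j i, h k i, h k j]
  ring

/-- The inverse metric is parallel. Differentiating `G G⁻¹ = 1` gives `∂G⁻¹ = -G⁻¹ (∂G) G⁻¹`, and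
metric compatibility reads `∂G = GΓ + (GΓ)ᵀ` for the matrix `Γ` with the direction `k` frozen. -/
lemma cpd_inv (k i j : Fin d) : cpd k (fun w => (G w)⁻¹ i j) y
    = - (∑ l, chr G i k l y * (G y)⁻¹ l j + ∑ l, chr G j k l y * (G y)⁻¹ l i) := by
  set D : Matrix (Fin d) (Fin d) ℝ := Matrix.of fun a b => cpd k (fun w => G w a b) y with hD
  set D' : Matrix (Fin d) (Fin d) ℝ := Matrix.of fun a b => cpd k (fun w => (G w)⁻¹ a b) y with hD'
  set Γ : Matrix (Fin d) (Fin d) ℝ := Matrix.of fun a b => chr G a k b y with hΓ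
  have h1 : D = G y * Γ + (G y * Γ).transpose := by
    ext a b
    simp only [hD, hΓ, Matrix.add_apply, Matrix.transpose_apply, Matrix.mul_apply,
      Matrix.of_apply, hG.cpd_metric hy k a b]
  have h2 : D * (G y)⁻¹ + G y * D' = 0 := by
    ext a b
    have : cpd k (fun w => ∑ l, G w a l * (G w)⁻¹ l b) y = 0 := by
      rw [cpd_congr_on hG.isOpen (fun z hz => hG.sum_mul_inv hz a b) hy, cpd_const]
    rw [cpd_sum _ fun l => (hG.smooth y hy a l).mul (hG.smooth_inv hy l b)] at this
    simp only [cpd_mul (hG.smooth y hy a _) (hG.smooth_inv hy _ b), Finset.sum_add_distrib] at this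
    simpa [Matrix.mul_apply, hD, hD'] using this
  have h3 : D' = - (Γ * (G y)⁻¹ + (Γ * (G y)⁻¹).transpose) := by
    have h4 : D' = - ((G y)⁻¹ * D * (G y)⁻¹) := by
      have := congrArg (fun X => (G y)⁻¹ * X) h2
      simp only [mul_add, ← mul_assoc, hG.inv_mul hy, one_mul, mul_zero] at this
      rw [eq_neg_iff_add_eq_zero, add_comm]
      exact this
    rw [h4, h1, Matrix.transpose_mul, Matrix.transpose_mul, hG.transpose_eq,
      Matrix.transpose_nonsing_inv, hG.transpose_eq]
    simp only [mul_add, add_mul, ← mul_assoc, hG.inv_mul hy, one_mul]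
    simp only [mul_assoc, hG.mul_inv hy, mul_one]
  have := congrFun (congrFun h3 i) j
  simpa only [hD', hΓ, Matrix.neg_apply, Matrix.add_apply, Matrix.transpose_apply,
    Matrix.mul_apply, Matrix.of_apply] using this

end MetricOn

end Coordinates

/-! ### The Ricci tensor of `s⁻² g`. -/

section ConformalChange

variable {d : ℕ}

/-- The difference of the Christoffel symbols of conformally related metrics. -/
def confDiff (g : Fin d → Fin d → ℝ) (u W : Fin d → ℝ) (k i j : Fin d) : ℝ :=
  -((if k = i then u j else 0) + (if k = j then u i else 0) - g i j * W k)

section Algebra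

variable (g : Fin d → Fin d → ℝ) (u W : Fin d → ℝ)

lemma sum_mul_confDiff (v : Fin d → ℝ) (i j : Fin d) :
    ∑ l, v l * confDiff g u W l i j = -(v i * u j + v j * u i - g i j * ∑ l, v l * W l) := by
  simp only [confDiff, mul_neg, Finset.sum_neg_distrib, mul_sub, mul_add, Finset.sum_sub_distrib,
    Finset.sum_add_distrib, mul_ite, mul_zero, Finset.sum_ite_eq', Finset.mem_univ, if_true,
    Finset.mul_sum]
  congr 2
  exact Finset.sum_congr rfl fun l _ => by ring

lemma trace_mul_confDiff (B : Fin d → Fin d → ℝ) (i : Fin d) :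
    ∑ k, ∑ l, B k l * confDiff g u W l i k
      = -(∑ k, B k i * u k + (∑ k, B k k) * u i - ∑ k, g i k * ∑ l, B k l * W l) := by
  simp only [sum_mul_confDiff, Finset.sum_neg_distrib, Finset.sum_sub_distrib,
    Finset.sum_add_distrib, Finset.sum_mul]

variable (hgW : ∀ i, ∑ l, g i l * W l = u i)
include hgW

lemma sum_confDiff_mul (k j : Fin d) :
    ∑ l, confDiff g u W k j l * W l = - if k = j then ∑ l, u l * W l else 0 := by
  have h1 : ∀ l, confDiff g u W k j l * W l = -((if k = j then u l * W l else 0)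
      + (if k = l then u j * W l else 0) - g j l * W l * W k) := by
    intro l
    simp only [confDiff]
    split_ifs <;> ring
  simp only [h1, Finset.sum_neg_distrib, Finset.sum_sub_distrib, Finset.sum_add_distrib,
    ← Finset.sum_mul, hgW, Finset.sum_ite_eq, Finset.mem_univ, if_true]
  split_ifs <;> simp

lemma trace_confDiff (i : Fin d) : ∑ k, confDiff g u W k i k = -(d * u i) := by
  simp only [confDiff, Finset.sum_neg_distrib, Finset.sum_sub_distrib, Finset.sum_add_distrib, hgW,
    Finset.sum_ite_eq', Finset.mem_univ, if_true, Finset.sum_const, Finset.card_univ,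
    Fintype.card_fin, nsmul_eq_mul]
  ring

/-- The algebra of the conformal change, freed from analysis: `dg`, `du`, `dW` stand for the partial
derivatives of the metric, of `u` and of the raised `W`. They are tied only by metric compatibility
(`hdg`), closedness of `u` (`hdu`) and the derivative of `g W = u` (`hd`). The right side is
`(d-2)(∇u + u⊗u - |u|² g) + g div W`. -/
lemma confDiff_ricci (hg : ∀ i j, g i j = g j i) (Γ dg : Fin d → Fin d → Fin d → ℝ)
    (hΓ : ∀ k i j, Γ k i j = Γ k j i)
    (hdg : ∀ k i j, dg k i j = ∑ l, g i l * Γ l k j + ∑ l, g j l * Γ l k i)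
    (du dW : Fin d → Fin d → ℝ) (hdu : ∀ i j, du i j = du j i)
    (hd : ∀ i j, ∑ k, (dg j i k * W k + g i k * dW j k) = du j i) (i j : Fin d) :
    ∑ k, (-((if k = i then du k j else 0) + (if k = j then du k i else 0)
          - (dg k i j * W k + g i j * dW k k))
        - -((if k = i then du j k else 0) + (if k = k then du j i else 0)
          - (dg j i k * W k + g i k * dW j k))
        + ∑ l, ((Γ k k l + confDiff g u W k k l) * (Γ l i j + confDiff g u W l i j)
          - (Γ k j l + confDiff g u W k j l) * (Γ l i k + confDiff g u W l i k)
          - (Γ k k l * Γ l i j - Γ k j l * Γ l i k)))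
      = ((d : ℝ) - 2) * (du i j - ∑ k, Γ k i j * u k + u i * u j - (∑ l, u l * W l) * g i j)
        + g i j * ∑ k, (dW k k + ∑ l, Γ k k l * W l) := by
  have e : ∀ k, (-((if k = i then du k j else 0) + (if k = j then du k i else 0)
          - (dg k i j * W k + g i j * dW k k))
        - -((if k = i then du j k else 0) + (if k = k then du j i else 0)
          - (dg j i k * W k + g i k * dW j k))
        + ∑ l, ((Γ k k l + confDiff g u W k k l) * (Γ l i j + confDiff g u W l i j)
          - (Γ k j l + confDiff g u W k j l) * (Γ l i k + confDiff g u W l i k)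
          - (Γ k k l * Γ l i j - Γ k j l * Γ l i k)))
      = -(if k = i then du k j else 0) - (if k = j then du k i else 0)
        + dg k i j * W k + g i j * dW k k
        + (if k = i then du j k else 0) + du j i - (dg j i k * W k + g i k * dW j k)
        + ∑ l, Γ k k l * confDiff g u W l i j
        + ∑ l, confDiff g u W k l k * (Γ l i j + confDiff g u W l i j)
        - ∑ l, Γ k j l * confDiff g u W l i k
        - ∑ l, Γ l i k * confDiff g u W k j l
        - ∑ l, confDiff g u W k j l * confDiff g u W l i k := by
    intro k
    have hs : ∀ l, confDiff g u W k k l = confDiff g u W k l k := by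
      intro l
      simp only [confDiff, hg k l]
      ring
    have : ∑ l, ((Γ k k l + confDiff g u W k k l) * (Γ l i j + confDiff g u W l i j)
          - (Γ k j l + confDiff g u W k j l) * (Γ l i k + confDiff g u W l i k)
          - (Γ k k l * Γ l i j - Γ k j l * Γ l i k))
        = ∑ l, Γ k k l * confDiff g u W l i j
        + ∑ l, confDiff g u W k l k * (Γ l i j + confDiff g u W l i j)
        - ∑ l, Γ k j l * confDiff g u W l i k
        - ∑ l, Γ l i k * confDiff g u W k j l
        - ∑ l, confDiff g u W k j l * confDiff g u W l i k := by
      simp only [← Finset.sum_add_distrib, ← Finset.sum_sub_distrib]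
      refine Finset.sum_congr rfl fun l _ => ?_
      rw [hs]
      ring
    rw [this, if_pos rfl]
    ring
  rw [Finset.sum_congr rfl fun k _ => e k]
  simp only [Finset.sum_add_distrib, Finset.sum_sub_distrib, Finset.sum_neg_distrib,
    Finset.sum_ite_eq', Finset.mem_univ, if_true]
  -- `t1`, `t3`, `t4` are linear in the difference tensor, `t5` is quadratic and `t2` contains both
  -- kinds; `t6` trades `∂g` for Christoffel symbols, and `t7` removes the remaining `g ∂W`.
  have t1 : ∑ k, ∑ l, Γ k k l * confDiff g u W l i j
      = -((∑ k, Γ k k i) * u j + (∑ k, Γ k k j) * u i - g i j * ∑ k, ∑ l, Γ k k l * W l) := by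
    simp only [sum_mul_confDiff, Finset.sum_neg_distrib, Finset.sum_sub_distrib,
      Finset.sum_add_distrib, Finset.sum_mul, Finset.mul_sum]
  have t2 : ∑ k, ∑ l, confDiff g u W k l k * (Γ l i j + confDiff g u W l i j)
      = -(d * (∑ l, Γ l i j * u l + -(u i * u j + u j * u i - g i j * ∑ l, u l * W l))) := by
    rw [Finset.sum_comm]
    simp only [← Finset.sum_mul, trace_confDiff g u W hgW]
    rw [← sum_mul_confDiff, ← Finset.sum_add_distrib, Finset.mul_sum, ← Finset.sum_neg_distrib]
    exact Finset.sum_congr rfl fun l _ => by ring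
  have t3 := trace_mul_confDiff g u W (fun k l => Γ k j l) i
  have t4 : ∑ k, ∑ l, Γ l i k * confDiff g u W k j l
      = -(∑ k, Γ k i j * u k + (∑ k, Γ k i k) * u j - ∑ k, g j k * ∑ l, Γ k i l * W l) := by
    rw [Finset.sum_comm]
    exact trace_mul_confDiff g u W (fun k l => Γ k i l) j
  have t5 : ∑ k, ∑ l, confDiff g u W k j l * confDiff g u W l i k
      = -(-(u j * u i + u i * u j - g j i * ∑ l, u l * W l) + (-(d * u j)) * u i
        + g i j * ∑ l, u l * W l) := by
    rw [trace_mul_confDiff g u W (fun k l => confDiff g u W k j l) i]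
    simp only [sum_confDiff_mul g u W hgW, trace_confDiff g u W hgW]
    rw [← sum_mul_confDiff]
    simp only [mul_comm (confDiff g u W _ _ _), mul_neg, mul_ite, mul_zero,
      Finset.sum_neg_distrib, Finset.sum_ite_eq', Finset.mem_univ, if_true]
    ring
  have t6 : ∑ k, dg k i j * W k = ∑ k, g i k * ∑ l, Γ k j l * W l
      + ∑ k, g j k * ∑ l, Γ k i l * W l := by
    simp only [hdg, add_mul, Finset.sum_add_distrib, Finset.sum_mul, Finset.mul_sum]
    congr 1
    · rw [Finset.sum_comm]
      refine Finset.sum_congr rfl fun l _ => Finset.sum_congr rfl fun k _ => ?_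
      rw [hΓ l k j]
      ring
    · rw [Finset.sum_comm]
      refine Finset.sum_congr rfl fun l _ => Finset.sum_congr rfl fun k _ => ?_
      rw [hΓ l k i]
      ring
  have t7 := hd i j
  simp only [Finset.sum_add_distrib] at t7
  have t8 : ∀ a, ∑ k, Γ k k a = ∑ k, Γ k a k := fun a => Finset.sum_congr rfl fun k _ => hΓ k k a
  have t9 : ∑ k, Γ k j i * u k = ∑ k, Γ k i j * u k :=
    Finset.sum_congr rfl fun k _ => by rw [hΓ k j i]
  rw [t1, t2, t3, t4, t5, t6, t8, t8, t9, hdu j i, hg j i]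
  simp only [Finset.sum_const, Finset.card_univ, Fintype.card_fin, nsmul_eq_mul]
  rw [hdu j i] at t7
  rw [← Finset.mul_sum]
  linear_combination -t7

end Algebra

/-- The Hessian `∂_i∂_j s - Γ^k_{ij} ∂_k s` in coordinates. -/
def hess (G : Eu d → Matrix (Fin d) (Fin d) ℝ) (s : Eu d → ℝ) (i j : Fin d) (y : Eu d) : ℝ :=
  cpd i (cpd j s) y - ∑ k, chr G k i j y * cpd k s y

variable {G : Eu d → Matrix (Fin d) (Fin d) ℝ} {U : Set (Eu d)} {y : Eu d}

namespace MetricOn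

lemma contDiffAt_raise (hG : MetricOn G U) (hy : y ∈ U) {u : Fin d → Eu d → ℝ}
    (hu : ∀ i, ContDiffAt ℝ ∞ (u i) y) (k : Fin d) :
    ContDiffAt ℝ ∞ (fun w => ∑ l, (G w)⁻¹ k l * u l w) y :=
  ContDiffAt.sum fun l _ => (hG.smooth_inv hy k l).mul (hu l)

lemma sum_mul_raise (hG : MetricOn G U) (hy : y ∈ U) (u : Fin d → ℝ) (i : Fin d) :
    ∑ l, G y i l * ∑ m, (G y)⁻¹ l m * u m = u i := by
  simp only [Finset.mul_sum]
  rw [Finset.sum_comm]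
  simp only [← mul_assoc, ← Finset.sum_mul, hG.sum_mul_inv hy]
  simp

/-- The divergence of a vector field obtained by raising an index. -/
lemma div_raise (hG : MetricOn G U) (hy : y ∈ U) {u : Fin d → Eu d → ℝ}
    (hu : ∀ i, ContDiffAt ℝ ∞ (u i) y) :
    ∑ k, (cpd k (fun w => ∑ l, (G w)⁻¹ k l * u l w) y
        + ∑ l, chr G k k l y * ∑ m, (G y)⁻¹ l m * u m y)
      = ∑ a, ∑ b, (G y)⁻¹ a b * (cpd a (u b) y - ∑ k, chr G k a b y * u k y) := by
  -- Of the two Christoffel sums in `∂g⁻¹`, one cancels the connection term of the divergence and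
  -- the other supplies the connection term of `∇u`.
  have e1 : ∀ k, cpd k (fun w => ∑ l, (G w)⁻¹ k l * u l w) y
      = -(∑ l, chr G k k l y * ∑ m, (G y)⁻¹ l m * u m y)
        - ∑ l, ∑ m, chr G l k m y * (G y)⁻¹ m k * u l y
        + ∑ l, (G y)⁻¹ k l * cpd k (u l) y := by
    intro k
    rw [cpd_sum _ fun l => (hG.smooth_inv hy k l).mul (hu l)]
    simp only [cpd_mul (hG.smooth_inv hy k _) (hu _), hG.cpd_inv hy, Finset.sum_add_distrib,
      neg_mul, add_mul, neg_add, Finset.sum_neg_distrib, Finset.sum_mul, Finset.mul_sum]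
    rw [Finset.sum_comm]
    simp only [mul_assoc, sub_eq_add_neg]
  simp only [e1, mul_sub, Finset.sum_sub_distrib, Finset.sum_add_distrib, Finset.sum_neg_distrib]
  have e2 : ∑ k, ∑ l, ∑ m, chr G l k m y * (G y)⁻¹ m k * u l y
      = ∑ a, ∑ b, (G y)⁻¹ a b * ∑ k, chr G k a b y * u k y := by
    refine Finset.sum_congr rfl fun k _ => ?_
    rw [Finset.sum_comm]
    refine Finset.sum_congr rfl fun m _ => ?_
    rw [Finset.mul_sum]
    refine Finset.sum_congr rfl fun l _ => ?_
    rw [hG.inv_symm y m k]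
    ring
  rw [e2]
  ring

section Rescale

variable (hG : MetricOn G U) {s : Eu d → ℝ} (hs : ∀ y ∈ U, ContDiffAt ℝ ∞ s y)
  (h0 : ∀ y ∈ U, s y ≠ 0)
include hG hs h0

lemma rescale : MetricOn (fun w => (s w ^ 2)⁻¹ • G w) U where
  isOpen := hG.isOpen
  smooth y hy i j := (((hs y hy).pow 2).inv (pow_ne_zero 2 (h0 y hy))).mul (hG.smooth y hy i j)
  symm y i j := by simp [hG.symm y i j]
  det_ne y hy := by
    rw [Matrix.det_smul]
    exact mul_ne_zero (pow_ne_zero _ (inv_ne_zero (pow_ne_zero 2 (h0 y hy)))) (hG.det_ne y hy)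

/-- The product rule is applied to `G = s² (s⁻² G)` and solved for the unknown derivative, so no
quotient has to be differentiated. -/
lemma cpd_rescale (hy : y ∈ U) (a i j : Fin d) :
    cpd a (fun w => ((s w ^ 2)⁻¹ • G w) i j) y
      = (s y ^ 2)⁻¹ * (cpd a (fun w => G w i j) y - 2 * (cpd a s y / s y) * G y i j) := by
  have hsm := (hG.rescale hs h0).smooth y hy i j
  have e : cpd a (fun w => G w i j) y
      = cpd a (fun w => (s w * s w) * ((s w ^ 2)⁻¹ • G w) i j) y := by
    refine cpd_congr_on hG.isOpen (fun z hz => ?_) hy a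
    have := h0 z hz
    simp only [Matrix.smul_apply, smul_eq_mul]
    field_simp
  rw [cpd_mul ((hs y hy).mul (hs y hy)) hsm, cpd_mul (hs y hy) (hs y hy)] at e
  have := h0 y hy
  rw [e]
  simp only [Matrix.smul_apply, smul_eq_mul]
  field_simp
  ring

/-- If `s⁻² = e^{2φ}` then `dφ = -ds/s`, which accounts for the overall sign in `confDiff`. Working
with `ds/s` instead of a logarithm requires only `s ≠ 0`, not a sign. -/
lemma chr_rescale (hy : y ∈ U) (k i j : Fin d) :
    chr (fun w => (s w ^ 2)⁻¹ • G w) k i j y = chr G k i j y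
      + confDiff (G y) (fun i => cpd i s y / s y)
        (fun k => ∑ l, (G y)⁻¹ k l * (cpd l s y / s y)) k i j := by
  have hp : s y ^ 2 ≠ 0 := pow_ne_zero 2 (h0 y hy)
  have e : ∀ l, ((s y ^ 2)⁻¹ • G y)⁻¹ k l * ((s y ^ 2)⁻¹ *
        (cpd i (fun w => G w j l) y - 2 * (cpd i s y / s y) * G y j l)
      + (s y ^ 2)⁻¹ * (cpd j (fun w => G w i l) y - 2 * (cpd j s y / s y) * G y i l)
      - (s y ^ 2)⁻¹ * (cpd l (fun w => G w i j) y - 2 * (cpd l s y / s y) * G y i j))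
      = (G y)⁻¹ k l * (cpd i (fun w => G w j l) y + cpd j (fun w => G w i l) y
        - cpd l (fun w => G w i j) y)
        - 2 * ((cpd i s y / s y) * ((G y)⁻¹ k l * G y l j)
          + (cpd j s y / s y) * ((G y)⁻¹ k l * G y l i)
          - G y i j * ((G y)⁻¹ k l * (cpd l s y / s y))) := by
    intro l
    have hs0 := h0 y hy
    rw [inv_smul_matrix _ (inv_ne_zero hp), hG.symm y j l, hG.symm y i l]
    simp only [Matrix.smul_apply, smul_eq_mul, inv_inv]
    generalize cpd i s y / s y = a1
    generalize cpd j s y / s y = a2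
    generalize cpd l s y / s y = a3
    field_simp
    ring
  simp only [chr, cpd_rescale hG hs h0 hy, e]
  rw [Finset.sum_sub_distrib, ← Finset.mul_sum, Finset.sum_sub_distrib, Finset.sum_add_distrib,
    ← Finset.mul_sum, ← Finset.mul_sum, ← Finset.mul_sum, hG.sum_inv_mul hy, hG.sum_inv_mul hy]
  simp only [confDiff]
  split_ifs <;> ring

omit hG in
lemma contDiffAt_logDeriv (hy : y ∈ U) (i : Fin d) :
    ContDiffAt ℝ ∞ (fun w => cpd i s w / s w) y :=
  (cpd_smooth (hs y hy) i).div (hs y hy) (h0 y hy)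

lemma cpd_logDeriv (hy : y ∈ U) (i j : Fin d) :
    cpd i (fun w => cpd j s w / s w) y
      = cpd i (cpd j s) y / s y - (cpd i s y / s y) * (cpd j s y / s y) := by
  have e : cpd i (cpd j s) y = cpd i (fun w => s w * (cpd j s w / s w)) y := by
    refine cpd_congr_on hG.isOpen (fun z hz => ?_) hy i
    have := h0 z hz
    field_simp
  rw [cpd_mul (hs y hy) (contDiffAt_logDeriv hs h0 hy j)] at e
  have := h0 y hy
  rw [e]
  field_simp
  ring

lemma cpd_chr_rescale (hy : y ∈ U) (a k i j : Fin d) :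
    cpd a (chr (fun w => (s w ^ 2)⁻¹ • G w) k i j) y = cpd a (chr G k i j) y
      + -((if k = i then cpd a (fun w => cpd j s w / s w) y else 0)
        + (if k = j then cpd a (fun w => cpd i s w / s w) y else 0)
        - (cpd a (fun w => G w i j) y * (∑ l, (G y)⁻¹ k l * (cpd l s y / s y))
          + G y i j * cpd a (fun w => ∑ l, (G w)⁻¹ k l * (cpd l s w / s w)) y)) := by
  rw [cpd_congr_on hG.isOpen (fun z hz => chr_rescale hG hs h0 hz k i j) hy]
  have hu := fun i => contDiffAt_logDeriv hs h0 hy i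
  have hW := hG.contDiffAt_raise hy hu k
  have h1 : ContDiffAt ℝ ∞ (fun w => if k = i then cpd j s w / s w else 0) y := by
    split_ifs
    exacts [hu j, contDiffAt_const]
  have h2 : ContDiffAt ℝ ∞ (fun w => if k = j then cpd i s w / s w else 0) y := by
    split_ifs
    exacts [hu i, contDiffAt_const]
  have h3 := (hG.smooth y hy i j).mul hW
  simp only [confDiff]
  rw [cpd_add (hG.smooth_chr hy k i j) ((h1.add h2).sub h3).neg, cpd_neg,
    cpd_sub (h1.add h2) h3, cpd_add h1 h2, cpd_mul (hG.smooth y hy i j) hW]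
  congr 4
  · split_ifs
    exacts [rfl, cpd_const _ _ _]
  · split_ifs
    exacts [rfl, cpd_const _ _ _]

/-- The Ricci tensor of `s⁻² g`. -/
lemma ricc_rescale (hy : y ∈ U) (i j : Fin d) :
    ricc (fun w => (s w ^ 2)⁻¹ • G w) i j y = ricc G i j y
      + ((d : ℝ) - 2) / s y * hess G s i j y
      + ((∑ a, ∑ b, (G y)⁻¹ a b * hess G s a b y) / s y
        - ((d : ℝ) - 1) / s y ^ 2 * ∑ a, ∑ b, (G y)⁻¹ a b * (cpd a s y * cpd b s y)) * G y i j := by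
  have hu := fun i => contDiffAt_logDeriv hs h0 hy i
  have hdu : ∀ i j, cpd i (fun w => cpd j s w / s w) y = cpd j (fun w => cpd i s w / s w) y := by
    intro i j
    rw [cpd_logDeriv hG hs h0 hy, cpd_logDeriv hG hs h0 hy, cpd_comm (hs y hy)]
    ring
  -- `∇u = Hess s / s - u⊗u` for `u = ds/s`; the last term will cancel the `u⊗u` in
  -- `confDiff_ricci`.
  have hh : ∀ a b, cpd a (fun w => cpd b s w / s w) y - ∑ k, chr G k a b y * (cpd k s y / s y)
      = hess G s a b y / s y - (cpd a s y / s y) * (cpd b s y / s y) := by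
    intro a b
    rw [cpd_logDeriv hG hs h0 hy, hess, sub_div, Finset.sum_div]
    simp only [mul_div_assoc]
    ring
  have key := confDiff_ricci (G y) (fun i => cpd i s y / s y)
    (fun k => ∑ l, (G y)⁻¹ k l * (cpd l s y / s y)) (fun i => hG.sum_mul_raise hy _ i)
    (fun i j => hG.symm y i j) (fun k i j => chr G k i j y)
    (fun k i j => cpd k (fun w => G w i j) y) (fun k i j => hG.chr_symm k i j y)
    (fun k i j => hG.cpd_metric hy k i j)
    (fun i j => cpd i (fun w => cpd j s w / s w) y)
    (fun a k => cpd a (fun w => ∑ l, (G w)⁻¹ k l * (cpd l s w / s w)) y) hdu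
    (by
      intro i j
      have e := cpd_congr_on hG.isOpen
        (fun z hz => hG.sum_mul_raise hz (fun l => cpd l s z / s z) i) hy j
      rw [cpd_sum _ fun l => (hG.smooth y hy i l).mul (hG.contDiffAt_raise hy hu l)] at e
      simpa only [cpd_mul (hG.smooth y hy i _) (hG.contDiffAt_raise hy hu _)] using e) i j
  rw [hG.div_raise hy hu] at key
  simp only [hh] at key
  have hn : ∑ l, cpd l s y / s y * ∑ m, (G y)⁻¹ l m * (cpd m s y / s y)
      = (∑ a, ∑ b, (G y)⁻¹ a b * (cpd a s y * cpd b s y)) / s y ^ 2 := by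
    simp only [Finset.sum_div, Finset.mul_sum]
    refine Finset.sum_congr rfl fun l _ => Finset.sum_congr rfl fun m _ => ?_
    ring
  have hn' : ∑ a, ∑ b, (G y)⁻¹ a b * (hess G s a b y / s y - cpd a s y / s y * (cpd b s y / s y))
      = (∑ a, ∑ b, (G y)⁻¹ a b * hess G s a b y) / s y
        - (∑ a, ∑ b, (G y)⁻¹ a b * (cpd a s y * cpd b s y)) / s y ^ 2 := by
    simp only [Finset.sum_div, ← Finset.sum_sub_distrib]
    refine Finset.sum_congr rfl fun l _ => Finset.sum_congr rfl fun m _ => ?_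
    ring
  rw [hn, hn'] at key
  have hl : ricc (fun w => (s w ^ 2)⁻¹ • G w) i j y - ricc G i j y
      = ((d : ℝ) - 2) * (hess G s i j y / s y - cpd i s y / s y * (cpd j s y / s y)
          + cpd i s y / s y * (cpd j s y / s y)
          - (∑ a, ∑ b, (G y)⁻¹ a b * (cpd a s y * cpd b s y)) / s y ^ 2 * G y i j)
        + G y i j * ((∑ a, ∑ b, (G y)⁻¹ a b * hess G s a b y) / s y
          - (∑ a, ∑ b, (G y)⁻¹ a b * (cpd a s y * cpd b s y)) / s y ^ 2) := by
    refine Eq.trans ?_ key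
    simp only [ricc, cpd_chr_rescale hG hs h0 hy, chr_rescale hG hs h0 hy]
    rw [← Finset.sum_sub_distrib]
    refine Finset.sum_congr rfl fun k _ => ?_
    rw [Finset.sum_sub_distrib (f := fun l => _ - _)]
    ring
  rw [sub_eq_iff_eq_add.1 hl]
  ring

end Rescale

end MetricOn

end ConformalChange

/-! ### Pullback of metrics and the transformation law of the Christoffel symbols. -/

section Tensoriality

variable {d : ℕ}

/-- The bilinear form with coefficients `c`. -/
def bf (c : Matrix (Fin d) (Fin d) ℝ) (v w : Fin d → ℝ) : ℝ := ∑ i, ∑ j, v i * w j * c i j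

lemma bf_symm {c : Matrix (Fin d) (Fin d) ℝ} (hc : ∀ i j, c i j = c j i) (v w : Fin d → ℝ) :
    bf c v w = bf c w v := by
  unfold bf
  rw [Finset.sum_comm]
  refine Finset.sum_congr rfl fun i _ => Finset.sum_congr rfl fun j _ => ?_
  rw [hc]
  ring

lemma bf_add_right (c : Matrix (Fin d) (Fin d) ℝ) (v w w' : Fin d → ℝ) :
    bf c v (fun i => w i + w' i) = bf c v w + bf c v w' := by
  simp only [bf, ← Finset.sum_add_distrib]
  refine Finset.sum_congr rfl fun i _ => Finset.sum_congr rfl fun j _ => ?_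
  ring

lemma bf_sum_right (c W : Matrix (Fin d) (Fin d) ℝ) (v a : Fin d → ℝ) :
    bf c v (fun i => ∑ k, W i k * a k) = ∑ k, a k * bf c v (fun i => W i k) := by
  simp only [bf, Finset.mul_sum, Finset.sum_mul]
  rw [Finset.sum_comm' (t' := Finset.univ) (s' := fun _ => Finset.univ) (by simp)]
  conv_rhs => rw [Finset.sum_comm]
  rw [Finset.sum_comm]
  refine Finset.sum_congr rfl fun i _ => ?_
  conv_rhs => rw [Finset.sum_comm]
  refine Finset.sum_congr rfl fun j _ => Finset.sum_congr rfl fun k _ => ?_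
  ring

lemma bf_eq_sum_left (c : Matrix (Fin d) (Fin d) ℝ) (v w : Fin d → ℝ) :
    bf c v w = ∑ i, v i * ∑ j, c i j * w j := by
  simp only [bf, Finset.mul_sum]
  refine Finset.sum_congr rfl fun i _ => Finset.sum_congr rfl fun j _ => ?_
  ring

variable {y : Eu d}

lemma contDiffAt_bf {c : Fin d → Fin d → Eu d → ℝ} (hc : ∀ i j, ContDiffAt ℝ ∞ (c i j) y)
    {v w : Fin d → Eu d → ℝ} (hv : ∀ i, ContDiffAt ℝ ∞ (v i) y)
    (hw : ∀ i, ContDiffAt ℝ ∞ (w i) y) :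
    ContDiffAt ℝ ∞ (fun z => bf (.of fun i j => c i j z) (fun i => v i z) (fun i => w i z)) y :=
  ContDiffAt.sum fun i _ => ContDiffAt.sum fun j _ => ((hv i).mul (hw j)).mul (hc i j)

lemma cpd_bf {c : Fin d → Fin d → Eu d → ℝ} (hc : ∀ i j, ContDiffAt ℝ ∞ (c i j) y)
    {v w : Fin d → Eu d → ℝ} (hv : ∀ i, ContDiffAt ℝ ∞ (v i) y)
    (hw : ∀ i, ContDiffAt ℝ ∞ (w i) y) (a : Fin d) :
    cpd a (fun z => bf (.of fun i j => c i j z) (fun i => v i z) (fun i => w i z)) y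
      = bf (.of fun i j => cpd a (c i j) y) (fun i => v i y) (fun i => w i y)
        + bf (.of fun i j => c i j y) (fun i => cpd a (v i) y) (fun i => w i y)
        + bf (.of fun i j => c i j y) (fun i => v i y) (fun i => cpd a (w i) y) := by
  simp only [bf, Matrix.of_apply]
  rw [cpd_sum _ fun i => ContDiffAt.sum fun j _ => ((hv i).mul (hw j)).mul (hc i j)]
  simp only [← Finset.sum_add_distrib]
  refine Finset.sum_congr rfl fun i _ => ?_
  rw [cpd_sum _ fun j => ((hv i).mul (hw j)).mul (hc i j)]
  refine Finset.sum_congr rfl fun j _ => ?_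
  rw [cpd_mul ((hv i).mul (hw j)) (hc i j), cpd_mul (hv i) (hw j)]
  ring

/-- The Jacobian matrix. -/
def jac (τ : Eu d → Eu d) (y : Eu d) : Matrix (Fin d) (Fin d) ℝ :=
  Matrix.of fun p i => cpd i (fun z => τ z p) y

lemma contDiffAt_coord {τ : Eu d → Eu d} (hτ : ContDiffAt ℝ ∞ τ y) (p : Fin d) :
    ContDiffAt ℝ ∞ (fun z => τ z p) y :=
  (EuclideanSpace.proj (𝕜 := ℝ) p).contDiff.contDiffAt.comp y hτ

lemma contDiffAt_jac {τ : Eu d → Eu d} (hτ : ContDiffAt ℝ ∞ τ y) (p i : Fin d) :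
    ContDiffAt ℝ ∞ (fun z => jac τ z p i) y :=
  cpd_smooth (contDiffAt_coord hτ p) i

lemma fderiv_eq_sum_cpd (f : Eu d → ℝ) (y v : Eu d) : fderiv ℝ f y v = ∑ i, v i * cpd i f y := by
  have : v = ∑ i, v i • ev i := by
    ext j
    simp [ev, Pi.single_apply]
  conv_lhs => rw [this]
  simp only [map_sum, map_smul, smul_eq_mul, cpd]

lemma cpd_comp {f : Eu d → ℝ} {τ : Eu d → Eu d} (hf : ContDiffAt ℝ ∞ f (τ y))
    (hτ : ContDiffAt ℝ ∞ τ y) (a : Fin d) :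
    cpd a (fun z => f (τ z)) y = ∑ r, jac τ y r a * cpd r f (τ y) := by
  have hd := smooth_differentiableAt hτ
  have h := ((smooth_differentiableAt hf).hasFDerivAt.comp y hd.hasFDerivAt).fderiv
  have e : (fun z => f (τ z)) = f ∘ τ := rfl
  rw [cpd, e, h, ContinuousLinearMap.comp_apply, fderiv_eq_sum_cpd]
  refine Finset.sum_congr rfl fun r _ => ?_
  congr 1
  have := ((EuclideanSpace.proj (𝕜 := ℝ) r).hasFDerivAt.comp y hd.hasFDerivAt).fderiv
  have e' : (fun z => τ z r) = (EuclideanSpace.proj (𝕜 := ℝ) r) ∘ τ := rfl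
  simp only [jac, Matrix.of_apply, cpd]
  rw [e', this]
  rfl

variable {G G' : Eu d → Matrix (Fin d) (Fin d) ℝ} {U V : Set (Eu d)}

/-- The metric `G'` is the pullback of `G` under the smooth map `τ`. -/
structure IsPullback (G' G : Eu d → Matrix (Fin d) (Fin d) ℝ) (V U : Set (Eu d))
    (τ : Eu d → Eu d) : Prop where
  source : MetricOn G' V
  target : MetricOn G U
  maps : ∀ y ∈ V, τ y ∈ U
  smooth : ∀ y ∈ V, ContDiffAt ℝ ∞ τ y
  eq : ∀ y ∈ V, G' y = (jac τ y).transpose * G (τ y) * jac τ y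

/-- The coefficients of a second derivative of the map. -/
def jac₂ (τ : Eu d → Eu d) (p i j : Fin d) (y : Eu d) : ℝ := cpd i (fun z => jac τ z p j) y

lemma conj_apply (A C : Matrix (Fin d) (Fin d) ℝ) (i j : Fin d) :
    (A.transpose * C * A) i j = bf C (fun p => A p i) (fun p => A p j) := by
  simp only [Matrix.mul_apply, bf, Matrix.transpose_apply, Finset.sum_mul]
  rw [Finset.sum_comm]
  refine Finset.sum_congr rfl fun p _ => Finset.sum_congr rfl fun q _ => ?_
  ring

namespace IsPullback

variable {τ : Eu d → Eu d} (h : IsPullback G' G V U τ) (hy : y ∈ V)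
include h hy

lemma jac₂_symm (p i j : Fin d) : jac₂ τ p i j y = jac₂ τ p j i y :=
  cpd_comm (contDiffAt_coord (h.smooth y hy) p) i j

lemma smooth_jac₂ (p i j : Fin d) : ContDiffAt ℝ ∞ (jac₂ τ p i j) y :=
  cpd_smooth (contDiffAt_jac (h.smooth y hy) p j) i

/-- Third derivatives of `τ` commute, so they drop out when the law for `∂Γ` is antisymmetrised to
obtain curvature. -/
lemma cpd_jac₂_symm (n p i j : Fin d) : cpd n (jac₂ τ p i j) y = cpd j (jac₂ τ p i n) y := by
  have e : ∀ n i j, cpd n (jac₂ τ p i j) y = cpd n (jac₂ τ p j i) y := fun n i j =>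
    cpd_congr_on h.source.isOpen (fun z hz => h.jac₂_symm hz p i j) hy n
  rw [e n i j, e j i n]
  exact cpd_comm (contDiffAt_jac (h.smooth y hy) p i) n j

/-- Nondegeneracy of both metrics forces the Jacobian to be invertible; no inverse of `τ` is needed.
-/
lemma det_jac_ne : (jac τ y).det ≠ 0 := by
  have := h.source.det_ne y hy
  rw [h.eq y hy, Matrix.det_mul] at this
  exact right_ne_zero_of_mul this

lemma eq_bf (i j : Fin d) :
    G' y i j = bf (G (τ y)) (fun p => jac τ y p i) (fun p => jac τ y p j) := by
  rw [h.eq y hy, conj_apply]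

/-- The derivative of the pulled back coefficients. -/
lemma cpd_bf_comp {c : Fin d → Fin d → Eu d → ℝ} (hc : ∀ i j, ContDiffAt ℝ ∞ (c i j) (τ y))
    (k i j : Fin d) :
    cpd k (fun z => bf (.of fun p q => c p q (τ z)) (fun p => jac τ z p i) (fun p => jac τ z p j)) y
      = ∑ r, jac τ y r k * bf (.of fun p q => cpd r (c p q) (τ y))
          (fun p => jac τ y p i) (fun p => jac τ y p j)
        + bf (.of fun p q => c p q (τ y)) (fun p => jac₂ τ p k i y) (fun p => jac τ y p j)
        + bf (.of fun p q => c p q (τ y)) (fun p => jac τ y p i) (fun p => jac₂ τ p k j y) := by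
  have hτ := h.smooth y hy
  rw [cpd_bf (c := fun p q z => c p q (τ z)) (v := fun p z => jac τ z p i)
    (w := fun p z => jac τ z p j) (fun p q => (hc p q).comp y hτ)
    (fun p => contDiffAt_jac hτ p i) (fun p => contDiffAt_jac hτ p j)]
  congr 2
  simp only [cpd_comp (hc _ _) hτ, bf, Matrix.of_apply, Finset.mul_sum]
  conv_rhs => rw [Finset.sum_comm]
  refine Finset.sum_congr rfl fun p _ => ?_
  conv_rhs => rw [Finset.sum_comm]
  refine Finset.sum_congr rfl fun q _ => Finset.sum_congr rfl fun r _ => ?_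
  ring

lemma cpd_metric (k i j : Fin d) :
    cpd k (fun z => G' z i j) y
      = ∑ r, jac τ y r k * bf (.of fun p q => cpd r (fun z => G z p q) (τ y))
          (fun p => jac τ y p i) (fun p => jac τ y p j)
        + bf (G (τ y)) (fun p => jac₂ τ p k i y) (fun p => jac τ y p j)
        + bf (G (τ y)) (fun p => jac τ y p i) (fun p => jac₂ τ p k j y) := by
  rw [cpd_congr_on h.source.isOpen (fun z hz => h.eq_bf hz i j) hy]
  exact h.cpd_bf_comp hy (c := fun p q z => G z p q) (h.target.smooth _ (h.maps y hy)) k i j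

/-- The transformation law of the Christoffel symbols. -/
lemma sum_jac_chr (m i j : Fin d) :
    ∑ k, jac τ y m k * chr G' k i j y
      = bf (.of fun p q => chr G m p q (τ y)) (fun p => jac τ y p i) (fun p => jac τ y p j)
        + jac₂ τ m i j y := by
  have hτU := h.maps y hy
  have hdet := h.det_jac_ne hy
  set X : Fin d → ℝ := fun m => bf (.of fun p q => chr G m p q (τ y)) (fun p => jac τ y p i) (fun p => jac τ y p j)
        + jac₂ τ m i j y with hX
  have hs : ∀ v w, bf (G (τ y)) v w = bf (G (τ y)) w v :=
    fun v w => bf_symm (fun i j => h.target.symm _ i j) v w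
  -- The law is checked after lowering the index with `G' = Jᵀ G J`, where the left side is a
  -- Christoffel symbol of the first kind. The invertible factor `Jᵀ G` is cancelled at the end.
  have key : ∀ n, ∑ l, G' y n l * chr G' l i j y = bf (G (τ y)) (fun p => jac τ y p n) X := by
    intro n
    rw [h.source.sum_mul_chr hy, h.cpd_metric hy, h.cpd_metric hy, h.cpd_metric hy]
    have e1 : bf (G (τ y)) (fun p => jac τ y p n) X
        = bf (G (τ y)) (fun p => jac τ y p n) (fun m => bf (.of fun p q => chr G m p q (τ y))
          (fun p => jac τ y p i) (fun p => jac τ y p j))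
          + bf (G (τ y)) (fun p => jac τ y p n) (fun m => jac₂ τ m i j y) := bf_add_right _ _ _ _
    have e2 : bf (G (τ y)) (fun p => jac τ y p n) (fun m => bf (.of fun p q => chr G m p q (τ y))
          (fun p => jac τ y p i) (fun p => jac τ y p j))
        = ∑ r, ∑ p, ∑ q, jac τ y r n * jac τ y p i * jac τ y q j * ∑ l, G (τ y) r l * chr G l p q (τ y) := by
      rw [bf_eq_sum_left]
      refine Finset.sum_congr rfl fun r _ => ?_
      simp only [bf, Matrix.of_apply, Finset.mul_sum]
      rw [Finset.sum_comm]
      refine Finset.sum_congr rfl fun p _ => ?_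
      rw [Finset.sum_comm]
      refine Finset.sum_congr rfl fun q _ => Finset.sum_congr rfl fun l _ => ?_
      ring
    have e3 : ∑ r, ∑ p, ∑ q, jac τ y r n * jac τ y p i * jac τ y q j * ∑ l, G (τ y) r l * chr G l p q (τ y)
        = (1 / 2 : ℝ) * (∑ r, jac τ y r i * bf (.of fun p q => cpd r (fun z => G z p q) (τ y))
            (fun p => jac τ y p j) (fun p => jac τ y p n)
          + ∑ r, jac τ y r j * bf (.of fun p q => cpd r (fun z => G z p q) (τ y))
            (fun p => jac τ y p i) (fun p => jac τ y p n)
          - ∑ r, jac τ y r n * bf (.of fun p q => cpd r (fun z => G z p q) (τ y))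
            (fun p => jac τ y p i) (fun p => jac τ y p j)) := by
      have f1 : ∑ r, jac τ y r i * bf (.of fun p q => cpd r (fun z => G z p q) (τ y))
            (fun p => jac τ y p j) (fun p => jac τ y p n)
          = ∑ r, ∑ p, ∑ q, jac τ y r n * jac τ y p i * jac τ y q j * cpd p (fun z => G z q r) (τ y) := by
        simp only [bf, Matrix.of_apply, Finset.mul_sum]
        conv_rhs => rw [Finset.sum_comm]
        refine Finset.sum_congr rfl fun p _ => ?_
        conv_rhs => rw [Finset.sum_comm]
        refine Finset.sum_congr rfl fun q _ => Finset.sum_congr rfl fun r _ => ?_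
        ring
      have f2 : ∑ r, jac τ y r j * bf (.of fun p q => cpd r (fun z => G z p q) (τ y))
            (fun p => jac τ y p i) (fun p => jac τ y p n)
          = ∑ r, ∑ p, ∑ q, jac τ y r n * jac τ y p i * jac τ y q j * cpd q (fun z => G z p r) (τ y) := by
        simp only [bf, Matrix.of_apply, Finset.mul_sum]
        conv_rhs => rw [Finset.sum_comm]
        rw [Finset.sum_comm]
        refine Finset.sum_congr rfl fun p _ => ?_
        conv_rhs => rw [Finset.sum_comm]
        refine Finset.sum_congr rfl fun q _ => Finset.sum_congr rfl fun r _ => ?_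
        ring
      rw [f1, f2]
      simp only [bf, Matrix.of_apply, Finset.mul_sum, ← Finset.sum_add_distrib, ← Finset.sum_sub_distrib]
      refine Finset.sum_congr rfl fun r _ => Finset.sum_congr rfl fun p _ =>
        Finset.sum_congr rfl fun q _ => ?_
      rw [← Finset.mul_sum, h.target.sum_mul_chr hτU]
      ring
    -- Of the six second-derivative terms, four cancel in pairs by symmetry, and the two that remain
    -- are equal and absorb the factor `1/2`.
    have hJ : ∀ a b, (fun p => jac₂ τ p a b y) = fun p => jac₂ τ p b a y :=
      fun a b => funext fun p => h.jac₂_symm hy p a b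
    rw [e1, e2, e3, hJ j i, hJ n i, hJ n j, hs (fun p => jac₂ τ p i j y),
      hs (fun p => jac₂ τ p i n y)]
    ring
  have key2 : ((jac τ y).transpose * G (τ y)).mulVec ((jac τ y).mulVec fun k => chr G' k i j y)
      = ((jac τ y).transpose * G (τ y)).mulVec X := by
    rw [Matrix.mulVec_mulVec, ← h.eq y hy, ← Matrix.mulVec_mulVec]
    ext n
    have := key n
    rw [bf_eq_sum_left] at this
    simpa only [Matrix.mulVec, dotProduct, Matrix.transpose_apply] using this
  have hu : IsUnit ((jac τ y).transpose * G (τ y)) := by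
    rw [Matrix.isUnit_iff_isUnit_det, Matrix.det_mul, Matrix.det_transpose]
    exact isUnit_iff_ne_zero.2 (mul_ne_zero hdet (h.target.det_ne _ hτU))
  have := congrFun (Matrix.mulVec_injective_of_isUnit hu key2) m
  simpa only [Matrix.mulVec, dotProduct, hX] using this

end IsPullback

end Tensoriality

/-! ### Transformation laws of curvature and Hessian. -/

section Tensoriality

variable {d : ℕ} {y : Eu d} {G G' : Eu d → Matrix (Fin d) (Fin d) ℝ} {U V : Set (Eu d)}

/-- The Riemann tensor: `∂_n Γ^l_{ij} - ∂_j Γ^l_{in} + Γ^l_{nk} Γ^k_{ij} - Γ^l_{jk} Γ^k_{in}`. -/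
def riem (G : Eu d → Matrix (Fin d) (Fin d) ℝ) (l n j i : Fin d) (y : Eu d) : ℝ :=
  cpd n (chr G l i j) y - cpd j (chr G l i n) y
    + ∑ k, (chr G l n k y * chr G k i j y - chr G l j k y * chr G k i n y)

lemma ricc_eq_sum_riem (G : Eu d → Matrix (Fin d) (Fin d) ℝ) (i j : Fin d) (y : Eu d) :
    ricc G i j y = ∑ k, riem G k k j i y := rfl

namespace IsPullback

variable {τ : Eu d → Eu d} (h : IsPullback G' G V U τ) (hy : y ∈ V)
include h hy

/-- The derivative of the transformation law of the Christoffel symbols. -/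
lemma sum_jac_cpd_chr (m n i j : Fin d) :
    ∑ k, jac τ y m k * (cpd n (chr G' k i j) y + ∑ l, chr G' k n l y * chr G' l i j y)
      = ∑ r, jac τ y r n * (bf (.of fun p q => cpd r (chr G m p q) (τ y))
            (fun p => jac τ y p i) (fun p => jac τ y p j)
          + ∑ l, chr G m r l (τ y) * bf (.of fun p q => chr G l p q (τ y))
            (fun p => jac τ y p i) (fun p => jac τ y p j))
        + (bf (.of fun p q => chr G m p q (τ y)) (fun p => jac τ y p n) (fun p => jac₂ τ p i j y)
          + bf (.of fun p q => chr G m p q (τ y)) (fun p => jac₂ τ p n i y) (fun p => jac τ y p j)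
          + bf (.of fun p q => chr G m p q (τ y)) (fun p => jac τ y p i) (fun p => jac₂ τ p n j y)
          + cpd n (jac₂ τ m i j) y) := by
  have hτ := h.smooth y hy
  have hτU := h.maps y hy
  have hc := fun p q => h.target.smooth_chr hτU m p q
  have e := cpd_congr_on h.source.isOpen (fun z hz => h.sum_jac_chr hz m i j) hy n
  rw [cpd_sum _ fun k => (contDiffAt_jac hτ m k).mul (h.source.smooth_chr hy k i j),
    cpd_add (contDiffAt_bf (c := fun p q z => chr G m p q (τ z)) (v := fun p z => jac τ z p i)
      (w := fun p z => jac τ z p j) (fun p q => (hc p q).comp y hτ)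
      (fun p => contDiffAt_jac hτ p i) (fun p => contDiffAt_jac hτ p j)) (h.smooth_jac₂ hy m i j),
    h.cpd_bf_comp hy hc] at e
  simp only [cpd_mul (contDiffAt_jac hτ m _) (h.source.smooth_chr hy _ i j),
    Finset.sum_add_distrib] at e
  -- The derivative of the Jacobian is itself expressed through the law for `Γ'`. This produces the
  -- quadratic terms `Γ'Γ'` and `ΓΓ` while keeping `J` on the left, so `J⁻¹` never appears.
  have e1 : ∑ k, cpd n (fun z => jac τ z m k) y * chr G' k i j y
      = ∑ k, jac τ y m k * (∑ l, chr G' k n l y * chr G' l i j y)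
        - bf (.of fun p q => chr G m p q (τ y)) (fun p => jac τ y p n)
          (fun q => bf (.of fun p' q' => chr G q p' q' (τ y))
            (fun p => jac τ y p i) (fun p => jac τ y p j))
        - bf (.of fun p q => chr G m p q (τ y)) (fun p => jac τ y p n)
          (fun p => jac₂ τ p i j y) := by
    have hk : ∀ k, cpd n (fun z => jac τ z m k) y = ∑ l, jac τ y m l * chr G' l n k y
        - bf (.of fun p q => chr G m p q (τ y)) (fun p => jac τ y p n) (fun p => jac τ y p k) :=
      fun k => eq_sub_iff_add_eq'.2 (h.sum_jac_chr hy m n k).symm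
    simp only [hk]
    have f1 : bf (.of fun p q => chr G m p q (τ y)) (fun p => jac τ y p n)
          (fun q => ∑ k, jac τ y q k * chr G' k i j y)
        = bf (.of fun p q => chr G m p q (τ y)) (fun p => jac τ y p n)
          (fun q => bf (.of fun p' q' => chr G q p' q' (τ y))
            (fun p => jac τ y p i) (fun p => jac τ y p j))
        + bf (.of fun p q => chr G m p q (τ y)) (fun p => jac τ y p n)
          (fun p => jac₂ τ p i j y) := by
      rw [← bf_add_right]
      congr 1
      exact funext fun q => h.sum_jac_chr hy q i j
    rw [bf_sum_right] at f1
    rw [sub_sub, ← f1]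
    simp only [sub_mul, Finset.sum_sub_distrib]
    congr 1
    · simp only [Finset.sum_mul, Finset.mul_sum]
      rw [Finset.sum_comm]
      refine Finset.sum_congr rfl fun l _ => Finset.sum_congr rfl fun k _ => ?_
      ring
    · exact Finset.sum_congr rfl fun k _ => mul_comm _ _
  rw [e1, bf_eq_sum_left] at e
  simp only [Matrix.of_apply] at e
  simp only [mul_add, Finset.sum_add_distrib]
  linear_combination e

/-- The transformation law of the Riemann tensor. -/
lemma sum_jac_riem (m n j i : Fin d) :
    ∑ l, jac τ y m l * riem G' l n j i y
      = ∑ r, jac τ y r n * bf (.of fun p q => riem G m r q p (τ y))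
          (fun p => jac τ y p i) (fun p => jac τ y p j) := by
  have hτU := h.maps y hy
  -- `k2` is `k1` with `n` and `j` exchanged. All terms with second or third derivatives of `τ` are
  -- symmetric in these indices and disappear from the difference.
  have k1 := h.sum_jac_cpd_chr hy m n i j
  have k2 := h.sum_jac_cpd_chr hy m j i n
  have hJ : ∀ a b, (fun p => jac₂ τ p a b y) = fun p => jac₂ τ p b a y :=
    fun a b => funext fun p => h.jac₂_symm hy p a b
  have hs : ∀ v w, bf (.of fun p q => chr G m p q (τ y)) v w
      = bf (.of fun p q => chr G m p q (τ y)) w v :=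
    fun v w => bf_symm (fun i j => h.target.chr_symm m i j _) v w
  rw [hJ j n, hJ j i, hJ i n, ← h.cpd_jac₂_symm hy n m i j,
    hs (fun p => jac₂ τ p i j y), hs (fun p => jac τ y p j)] at k2
  have hl : ∑ l, jac τ y m l * riem G' l n j i y
      = ∑ k, jac τ y m k * (cpd n (chr G' k i j) y + ∑ l, chr G' k n l y * chr G' l i j y)
        - ∑ k, jac τ y m k * (cpd j (chr G' k i n) y + ∑ l, chr G' k j l y * chr G' l i n y) := by
    rw [← Finset.sum_sub_distrib]
    refine Finset.sum_congr rfl fun l _ => ?_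
    rw [riem, Finset.sum_sub_distrib]
    ring
  have swap : ∀ X : Fin d → Fin d → Fin d → ℝ,
      ∑ r, jac τ y r j * bf (.of fun p q => X r p q) (fun p => jac τ y p i) (fun p => jac τ y p n)
      = ∑ r, jac τ y r n * bf (.of fun p q => X q p r)
          (fun p => jac τ y p i) (fun p => jac τ y p j) := by
    intro X
    simp only [bf, Matrix.of_apply, Finset.mul_sum]
    rw [Finset.sum_comm]
    conv_rhs => rw [Finset.sum_comm]
    refine Finset.sum_congr rfl fun p _ => ?_
    rw [Finset.sum_comm]
    refine Finset.sum_congr rfl fun q _ => Finset.sum_congr rfl fun r _ => ?_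
    ring
  have comb : ∀ (r a b : Fin d), bf (.of fun p q => cpd r (chr G m p q) (τ y))
            (fun p => jac τ y p a) (fun p => jac τ y p b)
          + ∑ l, chr G m r l (τ y) * bf (.of fun p q => chr G l p q (τ y))
            (fun p => jac τ y p a) (fun p => jac τ y p b)
      = bf (.of fun p q => cpd r (chr G m p q) (τ y) + ∑ l, chr G m r l (τ y) * chr G l p q (τ y))
          (fun p => jac τ y p a) (fun p => jac τ y p b) := by
    intro r a b
    simp only [bf, Matrix.of_apply, mul_add, Finset.sum_add_distrib, Finset.mul_sum]
    congr 1
    rw [Finset.sum_comm]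
    refine Finset.sum_congr rfl fun p _ => ?_
    rw [Finset.sum_comm]
    refine Finset.sum_congr rfl fun q _ => Finset.sum_congr rfl fun r _ => ?_
    ring
  simp only [comb] at k1 k2
  rw [swap fun r p q => cpd r (chr G m p q) (τ y)
    + ∑ l, chr G m r l (τ y) * chr G l p q (τ y)] at k2
  have hr : ∑ r, jac τ y r n * bf (.of fun p q => riem G m r q p (τ y))
          (fun p => jac τ y p i) (fun p => jac τ y p j)
      = ∑ r, jac τ y r n * bf (.of fun p q => cpd r (chr G m p q) (τ y)
          + ∑ l, chr G m r l (τ y) * chr G l p q (τ y))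
          (fun p => jac τ y p i) (fun p => jac τ y p j)
        - ∑ r, jac τ y r n * bf (.of fun p q => cpd q (chr G m p r) (τ y)
          + ∑ l, chr G m q l (τ y) * chr G l p r (τ y))
          (fun p => jac τ y p i) (fun p => jac τ y p j) := by
    simp only [bf, Matrix.of_apply, Finset.mul_sum, ← Finset.sum_sub_distrib]
    refine Finset.sum_congr rfl fun r _ => Finset.sum_congr rfl fun p _ =>
      Finset.sum_congr rfl fun q _ => ?_
    rw [riem, Finset.sum_sub_distrib]
    ring
  rw [hl, hr, k1, k2]
  ring

/-- The transformation law of the Ricci tensor. -/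
lemma ricc_eq (i j : Fin d) :
    ricc G' i j y = bf (.of fun p q => ricc G p q (τ y))
      (fun p => jac τ y p i) (fun p => jac τ y p j) := by
  set R : Matrix (Fin d) (Fin d) ℝ := .of fun l n => riem G' l n j i y with hR
  set Q : Matrix (Fin d) (Fin d) ℝ := .of fun m r => bf (.of fun p q => riem G m r q p (τ y))
      (fun p => jac τ y p i) (fun p => jac τ y p j) with hQ
  -- With `i` and `j` fixed, the law for Riemann says that `J` intertwines `R` and `Q`; similar
  -- matrices have the same trace, and these traces are the two Ricci tensors.
  have e : jac τ y * R = Q * jac τ y := by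
    ext m n
    simp only [Matrix.mul_apply, hR, hQ, Matrix.of_apply, h.sum_jac_riem hy m n j i]
    exact Finset.sum_congr rfl fun r _ => mul_comm _ _
  have hu : IsUnit (jac τ y).det := isUnit_iff_ne_zero.2 (h.det_jac_ne hy)
  have e2 : R = (jac τ y)⁻¹ * (Q * jac τ y) := by
    rw [← e, ← mul_assoc, Matrix.nonsing_inv_mul _ hu, one_mul]
  have e3 : R.trace = Q.trace := by
    rw [e2, Matrix.trace_mul_comm, mul_assoc, Matrix.mul_nonsing_inv _ hu, mul_one]
  simp only [Matrix.trace, Matrix.diag_apply, hR, hQ, Matrix.of_apply] at e3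
  rw [ricc_eq_sum_riem, e3]
  simp only [bf, Matrix.of_apply, ricc_eq_sum_riem, Finset.mul_sum]
  rw [Finset.sum_comm]
  refine Finset.sum_congr rfl fun p _ => ?_
  rw [Finset.sum_comm]

/-- The transformation law of the Hessian. -/
lemma hess_eq {s : Eu d → ℝ} (hs : ∀ z ∈ U, ContDiffAt ℝ ∞ s z) (i j : Fin d) :
    hess G' (fun z => s (τ z)) i j y = bf (.of fun p q => hess G s p q (τ y))
      (fun p => jac τ y p i) (fun p => jac τ y p j) := by
  have hτ := h.smooth y hy
  have hsy := hs _ (h.maps y hy)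
  have hps : ∀ p, ContDiffAt ℝ ∞ (fun z => cpd p s (τ z)) y :=
    fun p => (cpd_smooth hsy p).comp y hτ
  have e1 : cpd i (cpd j fun z => s (τ z)) y
      = ∑ p, (jac₂ τ p i j y * cpd p s (τ y)
        + jac τ y p j * ∑ r, jac τ y r i * cpd r (cpd p s) (τ y)) := by
    rw [cpd_congr_on h.source.isOpen (fun z hz => cpd_comp (hs _ (h.maps z hz)) (h.smooth z hz) j)
      hy, cpd_sum _ fun p => (contDiffAt_jac hτ p j).mul (hps p)]
    refine Finset.sum_congr rfl fun p _ => ?_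
    rw [cpd_mul (contDiffAt_jac hτ p j) (hps p),
      cpd_comp (cpd_smooth hsy p) hτ]
    rfl
  -- The inhomogeneous `jac₂` term of the Christoffel law is exactly the one that cancels against
  -- `e1`.
  have e2 : ∑ k, chr G' k i j y * cpd k (fun z => s (τ z)) y
      = ∑ p, (bf (.of fun a b => chr G p a b (τ y)) (fun p => jac τ y p i) (fun p => jac τ y p j)
        + jac₂ τ p i j y) * cpd p s (τ y) := by
    simp only [cpd_comp hsy hτ, ← h.sum_jac_chr hy, Finset.mul_sum, Finset.sum_mul]
    rw [Finset.sum_comm]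
    refine Finset.sum_congr rfl fun p _ => Finset.sum_congr rfl fun k _ => ?_
    ring
  have e3 : ∑ p, jac τ y p j * ∑ r, jac τ y r i * cpd r (cpd p s) (τ y)
      = bf (.of fun p q => cpd p (cpd q s) (τ y)) (fun p => jac τ y p i)
        (fun p => jac τ y p j) := by
    simp only [bf, Matrix.of_apply, Finset.mul_sum]
    rw [Finset.sum_comm]
    refine Finset.sum_congr rfl fun p _ => Finset.sum_congr rfl fun q _ => ?_
    ring
  have e4 : ∑ p, bf (.of fun a b => chr G p a b (τ y)) (fun p => jac τ y p i)
        (fun p => jac τ y p j) * cpd p s (τ y)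
      = bf (.of fun p q => ∑ k, chr G k p q (τ y) * cpd k s (τ y)) (fun p => jac τ y p i)
        (fun p => jac τ y p j) := by
    simp only [bf, Matrix.of_apply, Finset.mul_sum, Finset.sum_mul]
    rw [Finset.sum_comm]
    refine Finset.sum_congr rfl fun p _ => ?_
    rw [Finset.sum_comm]
    refine Finset.sum_congr rfl fun q _ => Finset.sum_congr rfl fun r _ => ?_
    ring
  rw [hess, e1, e2]
  simp only [add_mul, Finset.sum_add_distrib]
  rw [e3, e4]
  have e5 : bf (.of fun p q => hess G s p q (τ y)) (fun p => jac τ y p i) (fun p => jac τ y p j)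
      = bf (.of fun p q => cpd p (cpd q s) (τ y)) (fun p => jac τ y p i) (fun p => jac τ y p j)
      - bf (.of fun p q => ∑ k, chr G k p q (τ y) * cpd k s (τ y)) (fun p => jac τ y p i)
        (fun p => jac τ y p j) := by
    simp only [bf, Matrix.of_apply, hess, mul_sub, Finset.sum_sub_distrib]
  rw [e5]
  ring

end IsPullback

end Tensoriality

/-! ### From fields on the manifold to functions in a chart. -/

section Charts

variable {d : ℕ} {M : Type*} [TopologicalSpace M] [ChartedSpace (EuclideanSpace ℝ (Fin d)) M]

/-- The chart around `x₀`. -/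
abbrev ch (x₀ : M) : PartialEquiv M (Eu d) := extChartAt (𝓡 d) x₀

/-- A function in the chart around `x₀`. -/
def inChart (x₀ : M) (f : M → ℝ) (y : Eu d) : ℝ := f ((ch x₀).symm y)

lemma pd_eq (x₀ : M) (i : Fin d) (f : M → ℝ) (z : M) :
    pd x₀ i f z = cpd i (inChart x₀ f) (ch x₀ z) := rfl

lemma isOpen_ch_target (x₀ : M) : IsOpen (ch (d := d) x₀).target := isOpen_extChartAt_target x₀

lemma isOpen_ch_source (x₀ : M) : IsOpen (ch (d := d) x₀).source := isOpen_extChartAt_source x₀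

lemma ch_mem_target (x : M) : ch (d := d) x x ∈ (ch (d := d) x).target := mem_extChartAt_target x

lemma inChart_apply (x₀ : M) (f : M → ℝ) {z : M} (hz : z ∈ (ch (d := d) x₀).source) :
    inChart x₀ f (ch (d := d) x₀ z) = f z := by
  rw [inChart, (ch x₀).left_inv hz]

/-- The transition map from the chart around `z` to the chart around `x₀`. -/
def trans (z x₀ : M) (y : Eu d) : Eu d := ch x₀ ((ch z).symm y)

/-- The part of the chart around `z` that is covered by the chart around `x₀`. -/
def overlap (z x₀ : M) : Set (Eu d) :=
  (ch (d := d) z).target ∩ (ch (d := d) z).symm ⁻¹' (ch (d := d) x₀).source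

lemma isOpen_overlap (z x₀ : M) : IsOpen (overlap (d := d) z x₀) :=
  (continuousOn_extChartAt_symm z).isOpen_inter_preimage (isOpen_ch_target z) (isOpen_ch_source x₀)

lemma mem_overlap (z x₀ : M) (hx : z ∈ (ch (d := d) x₀).source) :
    ch (d := d) z z ∈ overlap z x₀ :=
  ⟨ch_mem_target z, by rw [mem_preimage, (ch z).left_inv (mem_extChartAt_source z)]; exact hx⟩

lemma trans_self_apply (z x₀ : M) : trans z x₀ (ch (d := d) z z) = ch x₀ z := by
  rw [trans, (ch z).left_inv (mem_extChartAt_source z)]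

variable [IsManifold (𝓡 d) ∞ M]

/-- The matrix of a bilinear form field in the chart around `x₀`. -/
def matChart (g : BilinField d M) (x₀ : M) (y : Eu d) : Matrix (Fin d) (Fin d) ℝ :=
  coeff g x₀ ((ch x₀).symm y)

lemma matChart_apply (g : BilinField d M) (x₀ : M) {z : M} (hz : z ∈ (ch (d := d) x₀).source) :
    matChart g x₀ (ch x₀ z) = coeff g x₀ z := by
  rw [matChart, (ch x₀).left_inv hz]

lemma christoffel_eq (g : BilinField d M) (x₀ : M) (k i j : Fin d) {z : M}
    (hz : z ∈ (ch (d := d) x₀).source) :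
    christoffel g x₀ k i j z = chr (matChart g x₀) k i j (ch x₀ z) := by
  unfold christoffel chr
  rw [matChart_apply g x₀ hz]
  rfl

lemma inChart_christoffel (g : BilinField d M) (x₀ : M) (k i j : Fin d) {y : Eu d}
    (hy : y ∈ (ch (d := d) x₀).target) :
    inChart x₀ (christoffel g x₀ k i j) y = chr (matChart g x₀) k i j y := by
  rw [inChart, christoffel_eq g x₀ k i j ((ch x₀).map_target hy), (ch x₀).right_inv hy]

lemma ricci_eq (g : BilinField d M) (x : M) (i j : Fin d) :
    ricci g x i j = ricc (matChart g x) i j (ch x x) := by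
  have hx : x ∈ (ch (d := d) x).source := mem_extChartAt_source x
  unfold ricci ricc
  refine Finset.sum_congr rfl fun k _ => ?_
  simp only [pd_eq, christoffel_eq g x _ _ _ hx]
  rw [cpd_congr_on (isOpen_ch_target x) (fun y hy => inChart_christoffel g x k i j hy)
    (ch_mem_target x), cpd_congr_on (isOpen_ch_target x)
    (fun y hy => inChart_christoffel g x k i k hy) (ch_mem_target x)]

lemma contDiffAt_inChart (x₀ : M) {f : M → ℝ} (hf : ContMDiff (𝓡 d) 𝓘(ℝ, ℝ) ∞ f) {y : Eu d}
    (hy : y ∈ (ch (d := d) x₀).target) : ContDiffAt ℝ ∞ (inChart x₀ f) y := by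
  rw [← contMDiffAt_iff_contDiffAt]
  exact hf.contMDiffAt.comp y ((contMDiffOn_extChartAt_symm x₀).contMDiffAt
    ((isOpen_ch_target x₀).mem_nhds hy))

lemma mdifferentiableAt_ch_symm (x₀ : M) {y : Eu d} (hy : y ∈ (ch (d := d) x₀).target) :
    MDifferentiableAt 𝓘(ℝ, Eu d) (𝓡 d) (ch x₀).symm y :=
  ((contMDiffOn_extChartAt_symm (n := ∞) x₀).contMDiffAt
    ((isOpen_ch_target x₀).mem_nhds hy)).mdifferentiableAt (by simp)

/-- Puts the coordinate frame in the form to which the chain rule applies. -/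
lemma frame_eq_mfderiv (x₀ : M) {z : M} (hz : z ∈ (ch (d := d) x₀).source) (i : Fin d) :
    frame x₀ z i = mfderiv 𝓘(ℝ, Eu d) (𝓡 d) (ch (d := d) x₀).symm (ch x₀ z) (ev i) := by
  unfold frame
  rw [TangentBundle.symmL_trivializationAt (by simpa using hz)]
  simp
  rfl

lemma dform_frame (x₀ : M) {f : M → ℝ} (hf : ContMDiff (𝓡 d) 𝓘(ℝ, ℝ) ∞ f) {z : M}
    (hz : z ∈ (ch (d := d) x₀).source) (i : Fin d) :
    dform f z (frame x₀ z i) = cpd i (inChart x₀ f) (ch x₀ z) := by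
  have hd := mdifferentiableAt_ch_symm x₀ ((ch (d := d) x₀).map_source hz)
  have hl := (ch (d := d) x₀).left_inv hz
  have hf' : MDifferentiableAt (𝓡 d) 𝓘(ℝ, ℝ) f
      ((ch (d := d) x₀).symm (ch x₀ z)) :=
    hf.contMDiffAt.mdifferentiableAt (by simp)
  have hc := mfderiv_comp (ch (d := d) x₀ z) hf' hd
  have e : inChart (d := d) x₀ f = f ∘ (ch (d := d) x₀).symm := rfl
  rw [frame_eq_mfderiv x₀ hz, cpd, e, ← mfderiv_eq_fderiv, hc]
  simp only [dform, mvfderiv]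
  rw [hl]
  rfl

lemma frame_basis (x₀ : M) {z : M} (hz : z ∈ (ch (d := d) x₀).source)
    (v : TangentSpace (𝓡 d) z) : ∃ a : Fin d → ℝ, v = ∑ i, a i • frame x₀ z i := by
  have hb : z ∈ (trivializationAt (Eu d) (TangentSpace (𝓡 d) : M → Type _) x₀).baseSet := by
    simpa using hz
  refine ⟨fun i => (trivializationAt (Eu d) (TangentSpace (𝓡 d) : M → Type _)
    x₀).continuousLinearMapAt ℝ z v i, ?_⟩
  conv_lhs => rw [← (trivializationAt (Eu d) (TangentSpace (𝓡 d) : M → Type _)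
    x₀).symmL_continuousLinearMapAt (R := ℝ) hb v]
  generalize (trivializationAt (Eu d) (TangentSpace (𝓡 d) : M → Type _)
    x₀).continuousLinearMapAt ℝ z v = a
  have ha : a = ∑ i, a i • ev i := by
    ext j
    simp [ev, Pi.single_apply]
  conv_lhs => rw [ha]
  simp only [map_sum, map_smul, frame]

lemma contDiffAt_trans (z x₀ : M) {y : Eu d} (hy : y ∈ overlap z x₀) :
    ContDiffAt ℝ ∞ (trans z x₀) y := by
  rw [← contMDiffAt_iff_contDiffAt]
  exact (contMDiffAt_extChartAt' (by simpa using hy.2)).comp y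
    ((contMDiffOn_extChartAt_symm z).contMDiffAt ((isOpen_ch_target z).mem_nhds hy.1))

/-- The chain rule for the inverse of the chart around `z`, which near the point factors as the
transition map followed by the inverse of the chart around `x₀`. -/
lemma frame_change (z x₀ : M) {w : M} (hz : w ∈ (ch (d := d) z).source)
    (hx : w ∈ (ch (d := d) x₀).source) (i : Fin d) :
    frame z w i = ∑ p, jac (trans z x₀) (ch z w) p i • frame x₀ w p := by
  have hzw := (ch (d := d) z).left_inv hz
  have hy : ch z w ∈ overlap (d := d) z x₀ := ⟨(ch z).map_source hz, by
    rw [mem_preimage, hzw]; exact hx⟩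
  have htw : trans z x₀ (ch (d := d) z w) = ch x₀ w := by rw [trans, hzw]
  have hd : MDifferentiableAt 𝓘(ℝ, Eu d) 𝓘(ℝ, Eu d) (trans z x₀) (ch z w) :=
    (smooth_differentiableAt (contDiffAt_trans z x₀ hy)).mdifferentiableAt
  have hs : MDifferentiableAt 𝓘(ℝ, Eu d) (𝓡 d) (ch (d := d) x₀).symm
      (trans z x₀ (ch (d := d) z w)) := by
    rw [htw]
    exact mdifferentiableAt_ch_symm x₀ ((ch x₀).map_source hx)
  have e : (ch (d := d) z).symm =ᶠ[𝓝 (ch (d := d) z w)] (ch (d := d) x₀).symm ∘ trans z x₀ :=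
    eventually_of_mem ((isOpen_overlap z x₀).mem_nhds hy) fun y hy => by
      simp only [Function.comp, trans]
      rw [(ch x₀).left_inv hy.2]
  rw [frame_eq_mfderiv z hz, e.mfderiv_eq, mfderiv_comp _ hs hd, htw]
  rw [hzw]
  have hv : fderiv ℝ (trans z x₀) (ch z w) (ev i)
      = ∑ p, jac (trans z x₀) (ch z w) p i • ev p := by
    have hc : ∀ p, (fderiv ℝ (trans z x₀) (ch (d := d) z w) (ev i)) p
        = jac (trans z x₀) (ch z w) p i := by
      intro p
      have h1 := ((EuclideanSpace.proj (𝕜 := ℝ) p).hasFDerivAt.comp (ch (d := d) z w)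
        (smooth_differentiableAt (contDiffAt_trans z x₀ hy)).hasFDerivAt).fderiv
      have h2 : (fun y => trans z x₀ y p) = (EuclideanSpace.proj (𝕜 := ℝ) p) ∘ trans z x₀ := rfl
      simp only [jac, Matrix.of_apply, cpd]
      rw [h2, h1]
      rfl
    simp only [← hc]
    ext j
    simp [ev, Pi.single_apply]
  have h4 : mfderiv 𝓘(ℝ, Eu d) 𝓘(ℝ, Eu d) (trans (d := d) z x₀) (ch z w) (ev i)
      = ∑ p, jac (trans z x₀) (ch z w) p i • ev p := by
    rw [mfderiv_eq_fderiv]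
    exact hv
  have h3 := congrArg (mfderiv 𝓘(ℝ, Eu d) (𝓡 d) (ch (d := d) x₀).symm (ch (d := d) x₀ w)) h4
  refine h3.trans ?_
  simp only [frame_eq_mfderiv x₀ hx]
  exact (map_sum (mfderiv 𝓘(ℝ, Eu d) (𝓡 d) (ch (d := d) x₀).symm (ch x₀ w)) _ _).trans
    (Finset.sum_congr rfl fun p _ => map_smul _ _ _)

lemma covector_change (z x₀ : M) {w : M} (hz : w ∈ (ch (d := d) z).source)
    (hx : w ∈ (ch (d := d) x₀).source) (α : TangentSpace (𝓡 d) w →L[ℝ] ℝ) :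
    (fun i => α (frame z w i))
      = (jac (trans z x₀) (ch z w)).transpose.mulVec fun p => α (frame x₀ w p) := by
  ext i
  rw [frame_change z x₀ hz hx]
  simp only [map_sum, map_smul, smul_eq_mul, Matrix.mulVec, dotProduct, Matrix.transpose_apply]

lemma coeff_change (g : BilinField d M) (z x₀ : M) {w : M} (hz : w ∈ (ch (d := d) z).source)
    (hx : w ∈ (ch (d := d) x₀).source) :
    coeff g z w = (jac (trans z x₀) (ch z w)).transpose * coeff g x₀ w
      * jac (trans z x₀) (ch z w) := by
  ext i j
  rw [conj_apply, coeff, Matrix.of_apply, frame_change z x₀ hz hx i, frame_change z x₀ hz hx j]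
  simp only [map_sum, map_smul, sum_apply, smul_apply, smul_eq_mul, bf, coeff, Matrix.of_apply,
    Finset.mul_sum]
  rw [Finset.sum_comm]
  refine Finset.sum_congr rfl fun p _ => Finset.sum_congr rfl fun q _ => ?_
  ring

lemma contDiffAt_coeff (g : SmoothMetric d M) (x₀ : M) {y : Eu d}
    (hy : y ∈ (ch (d := d) x₀).target) (i j : Fin d) :
    ContDiffAt ℝ ∞ (fun w => matChart g.inner x₀ w i j) y := by
  have hz : (ch x₀).symm y ∈ (ch (d := d) x₀).source := (ch x₀).map_target hy
  have hb : (ch x₀).symm y ∈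
      (trivializationAt (Eu d) (TangentSpace (𝓡 d) : M → Type _) x₀).baseSet := by
    simpa using hz
  have hf : ∀ i, ContMDiffAt (𝓡 d) ((𝓡 d).prod 𝓘(ℝ, Eu d)) ∞
      (fun m : M => TotalSpace.mk' (Eu d) (E := fun m : M => TangentSpace (𝓡 d) m) m
        (frame x₀ m i)) ((ch x₀).symm y) := by
    intro i
    have h1 := (trivializationAt (Eu d) (TangentSpace (𝓡 d) : M → Type _) x₀).contMDiffAt_symmL
      (IB := 𝓡 d) (𝕜 := ℝ) (n := ∞) hb
    have h2 : ContMDiffAt (𝓡 d) ((𝓡 d).prod 𝓘(ℝ, Eu d)) ∞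
      (fun m : M => TotalSpace.mk' (Eu d) (E := Bundle.Trivial M (Eu d)) m (ev i))
        ((ch x₀).symm y) := by
      rw [Bundle.contMDiffAt_section]
      exact contMDiffAt_const
    exact h1.clm_bundle_apply h2
  have h3 := (g.contMDiff ((ch x₀).symm y)).clm_bundle_apply₂ (F₁ := Eu d) (F₂ := Eu d)
    (F₃ := ℝ) (E₃ := Bundle.Trivial M ℝ) (hf i) (hf j)
  rw [Bundle.contMDiffAt_section] at h3
  rw [← contMDiffAt_iff_contDiffAt]
  exact h3.comp y ((contMDiffOn_extChartAt_symm x₀).contMDiffAt ((isOpen_ch_target x₀).mem_nhds hy))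

lemma posDef_coeff (g : SmoothMetric d M) (x₀ : M) {z : M} (hz : z ∈ (ch (d := d) x₀).source) :
    (coeff g.inner x₀ z).PosDef := by
  refine Matrix.PosDef.of_dotProduct_mulVec_pos ?_ fun v hv => ?_
  · ext i j
    exact g.symm _ _ _
  · have hb : z ∈ (trivializationAt (Eu d) (TangentSpace (𝓡 d) : M → Type _) x₀).baseSet := by
      simpa using hz
    have e : star v ⬝ᵥ (coeff g.inner x₀ z).mulVec v
        = g.inner z (∑ i, v i • frame x₀ z i) (∑ i, v i • frame x₀ z i) := by
      simp only [map_sum, map_smul, sum_apply, smul_apply, smul_eq_mul, dotProduct, Matrix.mulVec,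
        coeff, Matrix.of_apply, Finset.mul_sum, star_trivial]
      rw [Finset.sum_comm]
      refine Finset.sum_congr rfl fun p _ => Finset.sum_congr rfl fun q _ => ?_
      ring
    rw [e]
    refine g.pos _ _ fun h0 => hv ?_
    have h1 : ∑ i, v i • frame x₀ z i
        = (trivializationAt (Eu d) (TangentSpace (𝓡 d) : M → Type _) x₀).symmL ℝ z
          (∑ i, v i • ev i) := by
      simp only [map_sum, map_smul, frame]
    rw [h1] at h0
    have h2 := (trivializationAt (Eu d) (TangentSpace (𝓡 d) : M → Type _)
      x₀).continuousLinearMapAt_symmL (R := ℝ) hb (∑ i, v i • ev i)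
    rw [h0, map_zero] at h2
    ext j
    have := congrArg (fun w : Eu d => w j) h2
    simpa [ev, Pi.single_apply] using this.symm

lemma metricOn (g : SmoothMetric d M) (x₀ : M) :
    MetricOn (matChart g.inner x₀) (ch (d := d) x₀).target where
  isOpen := isOpen_ch_target x₀
  smooth _ hy := contDiffAt_coeff g x₀ hy
  symm _ _ _ := g.symm _ _ _
  det_ne _ hy := (posDef_coeff g x₀ ((ch x₀).map_target hy)).det_pos.ne'

lemma isPullback (g : SmoothMetric d M) (z x₀ : M) :
    IsPullback (matChart g.inner z) (matChart g.inner x₀) (overlap z x₀)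
      (ch (d := d) x₀).target (trans z x₀) where
  source := (metricOn g z).mono (isOpen_overlap z x₀) inter_subset_left
  target := metricOn g x₀
  maps _ hy := (ch x₀).map_source hy.2
  smooth _ hy := contDiffAt_trans z x₀ hy
  eq y hy := by
    have h := coeff_change g.inner z x₀ ((ch (d := d) z).map_target hy.1) hy.2
    rw [(ch z).right_inv hy.1] at h
    rw [matChart, h, trans, matChart_apply _ _ hy.2]

lemma inv_conj {A C : Matrix (Fin d) (Fin d) ℝ} (hA : A.det ≠ 0) :
    A * (A.transpose * C * A)⁻¹ * A.transpose = C⁻¹ := by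
  have hu : IsUnit A.det := isUnit_iff_ne_zero.2 hA
  have hu' : IsUnit A.transpose.det := by rwa [Matrix.det_transpose]
  rw [Matrix.mul_inv_rev, Matrix.mul_inv_rev, ← mul_assoc, Matrix.mul_nonsing_inv _ hu, one_mul,
    mul_assoc, Matrix.nonsing_inv_mul _ hu', mul_one]

/-- `coInner` is defined through the chart centred at the point itself. Reading it in a fixed chart
makes it a function of the point that can be differentiated. -/
lemma coInner_eq (g : SmoothMetric d M) (x₀ : M) {z : M} (hx : z ∈ (ch (d := d) x₀).source)
    (α β : TangentSpace (𝓡 d) z →L[ℝ] ℝ) :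
    coInner g.inner z α β = bf (coeff g.inner x₀ z)⁻¹ (fun i => α (frame x₀ z i))
      (fun i => β (frame x₀ z i)) := by
  have hz : z ∈ (ch (d := d) z).source := mem_extChartAt_source z
  have hA := (isPullback g z x₀).det_jac_ne (mem_overlap z x₀ hx)
  have hbf : ∀ (C : Matrix (Fin d) (Fin d) ℝ) v w, bf C v w = v ⬝ᵥ C.mulVec w := by
    intro C v w
    rw [bf_eq_sum_left]
    rfl
  have e : coInner g.inner z α β = bf (coeff g.inner z z)⁻¹ (fun i => α (frame z z i))
      (fun i => β (frame z z i)) := by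
    refine Finset.sum_congr rfl fun i _ => Finset.sum_congr rfl fun j _ => ?_
    ring
  rw [e, covector_change z x₀ hz hx, covector_change z x₀ hz hx, coeff_change _ z x₀ hz hx,
    hbf, hbf, Matrix.mulVec_mulVec, Matrix.mulVec_transpose, ← Matrix.dotProduct_mulVec,
    Matrix.mulVec_mulVec, ← mul_assoc, inv_conj hA]

lemma coInner_self_nonneg (g : SmoothMetric d M) (z : M) (α : TangentSpace (𝓡 d) z →L[ℝ] ℝ) :
    0 ≤ coInner g.inner z α α ∧ (coInner g.inner z α α = 0 → ∀ i, α (frame z z i) = 0) := by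
  have hz : z ∈ (ch (d := d) z).source := mem_extChartAt_source z
  have hp := (posDef_coeff g z hz).inv
  have e : coInner g.inner z α α = star (fun i => α (frame z z i)) ⬝ᵥ
      (coeff g.inner z z)⁻¹.mulVec (fun i => α (frame z z i)) := by
    rw [coInner_eq g z hz, bf_eq_sum_left]
    rfl
  rw [e]
  refine ⟨hp.posSemidef.dotProduct_mulVec_nonneg _, fun h => ?_⟩
  by_contra hc
  have : (fun i => α (frame z z i)) ≠ 0 := fun h0 => hc fun i => congrFun h0 i
  exact (hp.dotProduct_mulVec_pos this).ne' h

lemma covector_ext (x₀ : M) {z : M} (hz : z ∈ (ch (d := d) x₀).source)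
    {α β : TangentSpace (𝓡 d) z →L[ℝ] ℝ} (h : ∀ i, α (frame x₀ z i) = β (frame x₀ z i)) :
    α = β := by
  ext v
  obtain ⟨a, rfl⟩ := frame_basis x₀ hz v
  simp only [map_sum, map_smul, h]

end Charts

/-! ### The equations of a parallel tractor in coordinates. -/

section LocalTractor

variable {d : ℕ} {y : Eu d} {G G' : Eu d → Matrix (Fin d) (Fin d) ℝ} {U V : Set (Eu d)}

/-- The trace of the Schouten tensor in coordinates. -/
def schTrace (G : Eu d → Matrix (Fin d) (Fin d) ℝ) (y : Eu d) : ℝ :=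
  (∑ a, ∑ b, (G y)⁻¹ a b * ricc G a b y) / (2 * ((d : ℝ) - 1))

/-- The Schouten tensor in coordinates. -/
def sch (G : Eu d → Matrix (Fin d) (Fin d) ℝ) (i j : Fin d) (y : Eu d) : ℝ :=
  (ricc G i j y - schTrace G y * G y i j) / ((d : ℝ) - 2)

/-- The full contraction is a matrix trace, and cyclicity brings the two factors `A` together so
that `inv_conj` applies. -/
lemma sum_mul_conj {A C R : Matrix (Fin d) (Fin d) ℝ} (hA : A.det ≠ 0) (hC : C.transpose = C) :
    ∑ a, ∑ b, (A.transpose * C * A)⁻¹ a b * (A.transpose * R * A) a b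
      = ∑ a, ∑ b, C⁻¹ a b * R a b := by
  have e : ∀ X Y : Matrix (Fin d) (Fin d) ℝ, ∑ a, ∑ b, X a b * Y a b = (X.transpose * Y).trace := by
    intro X Y
    simp only [Matrix.trace, Matrix.diag_apply, Matrix.mul_apply, Matrix.transpose_apply]
    rw [Finset.sum_comm]
  have hs : (A.transpose * C * A).transpose = A.transpose * C * A := by
    rw [Matrix.transpose_mul, Matrix.transpose_mul, Matrix.transpose_transpose, hC, mul_assoc]
  rw [e, e, Matrix.transpose_nonsing_inv, hs, Matrix.transpose_nonsing_inv, hC, ← mul_assoc,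
    Matrix.trace_mul_comm, ← mul_assoc, ← mul_assoc, inv_conj hA]

namespace MetricOn

lemma smooth_sch (hG : MetricOn G U) (hy : y ∈ U) (i j : Fin d) :
    ContDiffAt ℝ ∞ (sch G i j) y := by
  unfold sch schTrace
  refine ((hG.smooth_ricc hy i j).sub (ContDiffAt.mul ?_ (hG.smooth y hy i j))).div_const _
  refine (ContDiffAt.sum fun a _ => ContDiffAt.sum fun b _ => ?_).div_const _
  exact (hG.smooth_inv hy a b).mul (hG.smooth_ricc hy a b)

lemma sum_inv_mul_self (hG : MetricOn G U) (hy : y ∈ U) :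
    ∑ a, ∑ b, (G y)⁻¹ a b * G y a b = d := by
  have : ∀ a, ∑ b, (G y)⁻¹ a b * G y a b = 1 := by
    intro a
    have := hG.sum_inv_mul hy a a
    rw [if_pos rfl] at this
    rw [← this]
    exact Finset.sum_congr rfl fun b _ => by rw [hG.symm y a b]
  simp [this]

/-- `tr Ric = 2(d-1)J`, hence `tr P = (2(d-1) - d) J / (d-2) = J`. -/
lemma trace_sch (hG : MetricOn G U) (hy : y ∈ U) (hd : 3 ≤ d) :
    ∑ a, ∑ b, (G y)⁻¹ a b * sch G a b y = schTrace G y := by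
  have h3 : (3 : ℝ) ≤ d := by exact_mod_cast hd
  have h2 : (d : ℝ) - 2 ≠ 0 := by linarith
  have h1 : (d : ℝ) - 1 ≠ 0 := by linarith
  have e : ∑ a, ∑ b, (G y)⁻¹ a b * sch G a b y
      = (∑ a, ∑ b, (G y)⁻¹ a b * ricc G a b y
        - schTrace G y * ∑ a, ∑ b, (G y)⁻¹ a b * G y a b) / ((d : ℝ) - 2) := by
    simp only [sch, Finset.mul_sum, ← Finset.sum_sub_distrib, Finset.sum_div]
    refine Finset.sum_congr rfl fun a _ => Finset.sum_congr rfl fun b _ => ?_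
    ring
  have hT : ∑ a, ∑ b, (G y)⁻¹ a b * ricc G a b y = schTrace G y * (2 * ((d : ℝ) - 1)) := by
    rw [schTrace]
    field_simp
  rw [e, hG.sum_inv_mul_self hy, hT]
  field_simp
  ring

/-- The two Christoffel sums in the derivative of the inverse metric become equal once contracted
with the symmetric `ds⊗ds`, and together they complete `∂∂s` to the Hessian. -/
lemma cpd_normSq (hG : MetricOn G U) (hy : y ∈ U) {s : Eu d → ℝ} (hs : ContDiffAt ℝ ∞ s y)
    (a : Fin d) :
    cpd a (fun z => bf (G z)⁻¹ (fun i => cpd i s z) (fun i => cpd i s z)) y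
      = 2 * ∑ l, hess G s a l y * ∑ m, (G y)⁻¹ l m * cpd m s y := by
  have hm := fun i => cpd_smooth hs i
  have h := cpd_bf (c := fun i j z => (G z)⁻¹ i j) (hG.smooth_inv hy) hm hm a
  refine h.trans ?_
  have hsym : ∀ v w, bf (.of fun i j => (G y)⁻¹ i j) v w
      = bf (.of fun i j => (G y)⁻¹ i j) w v := bf_symm (hG.inv_symm y)
  rw [hsym (fun i => cpd i s y) (fun i => cpd a (cpd i s) y)]
  have e1 : bf (.of fun i j => cpd a (fun z => (G z)⁻¹ i j) y) (fun i => cpd i s y)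
      (fun i => cpd i s y)
      = - 2 * ∑ l, (∑ k, chr G k a l y * cpd k s y) * ∑ m, (G y)⁻¹ l m * cpd m s y := by
    have f : ∀ p q : Fin d → Fin d → ℝ, bf (.of fun i j => -(p i j + q i j))
        (fun i => cpd i s y) (fun i => cpd i s y)
        = -(bf (.of p) (fun i => cpd i s y) (fun i => cpd i s y)
          + bf (.of fun i j => q j i) (fun i => cpd i s y) (fun i => cpd i s y)) := by
      intro p q
      simp only [bf, Matrix.of_apply, mul_neg, mul_add, Finset.sum_add_distrib,
        Finset.sum_neg_distrib]
      congr 2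
      rw [Finset.sum_comm]
      refine Finset.sum_congr rfl fun i _ => Finset.sum_congr rfl fun j _ => ?_
      ring
    simp only [hG.cpd_inv hy, f]
    have f2 : bf (.of fun i j => ∑ l, chr G i a l y * (G y)⁻¹ l j) (fun i => cpd i s y)
        (fun i => cpd i s y)
        = ∑ l, (∑ k, chr G k a l y * cpd k s y) * ∑ m, (G y)⁻¹ l m * cpd m s y := by
      simp only [bf, Matrix.of_apply, Finset.mul_sum, Finset.sum_mul]
      rw [Finset.sum_comm]
      conv_rhs => rw [Finset.sum_comm]
      refine Finset.sum_congr rfl fun i _ => ?_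
      conv_rhs => rw [Finset.sum_comm]
      refine Finset.sum_congr rfl fun j _ => Finset.sum_congr rfl fun l _ => ?_
      ring
    rw [f2]
    ring
  rw [e1, bf_eq_sum_left]
  simp only [Matrix.of_apply, hess, sub_mul, Finset.sum_sub_distrib]
  ring

end MetricOn

/-- The equations for a parallel tractor `(s, ds, r)` at a point in coordinates. -/
structure ParallelAt (G : Eu d → Matrix (Fin d) (Fin d) ℝ) (s r : Eu d → ℝ) (y : Eu d) : Prop where
  hess_eq : ∀ i j, hess G s i j y + G y i j * r y + sch G i j y * s y = 0
  cpd_eq : ∀ a, cpd a r y = ∑ b, sch G a b y * ∑ e, (G y)⁻¹ b e * cpd e s y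

namespace IsPullback

variable {τ : Eu d → Eu d} (h : IsPullback G' G V U τ) (hy : y ∈ V)
include h hy

lemma schTrace_eq : schTrace G' y = schTrace G (τ y) := by
  have e : (Matrix.of fun a b => ricc G' a b y)
      = (jac τ y).transpose * (Matrix.of fun a b => ricc G a b (τ y)) * jac τ y := by
    ext a b
    rw [conj_apply, Matrix.of_apply, h.ricc_eq hy]
  have := sum_mul_conj (R := Matrix.of fun a b => ricc G a b (τ y)) (h.det_jac_ne hy)
    (h.target.transpose_eq (τ y))
  rw [← e, ← h.eq y hy] at this
  simp only [Matrix.of_apply] at this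
  rw [schTrace, schTrace, this]

lemma sch_eq (i j : Fin d) : sch G' i j y = bf (.of fun p q => sch G p q (τ y))
    (fun p => jac τ y p i) (fun p => jac τ y p j) := by
  rw [sch, h.schTrace_eq hy, h.ricc_eq hy, h.eq_bf hy]
  simp only [bf, Matrix.of_apply, sch, Finset.mul_sum, Finset.sum_div, ← Finset.sum_sub_distrib]
  refine Finset.sum_congr rfl fun a _ => Finset.sum_congr rfl fun b _ => ?_
  ring

/-- The equations for parallel tractors do not depend on the coordinates. -/
lemma parallelAt {s r : Eu d → ℝ} (hs : ∀ z ∈ U, ContDiffAt ℝ ∞ s z)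
    (hr : ∀ z ∈ U, ContDiffAt ℝ ∞ r z)
    (hp : ParallelAt G' (fun z => s (τ z)) (fun z => r (τ z)) y) : ParallelAt G s r (τ y) := by
  have hu : IsUnit (jac τ y).det := isUnit_iff_ne_zero.2 (h.det_jac_ne hy)
  have hu' : IsUnit (jac τ y).transpose.det := by rwa [Matrix.det_transpose]
  have hτU := h.maps y hy
  constructor
  · set E : Matrix (Fin d) (Fin d) ℝ := .of fun i j =>
      hess G s i j (τ y) + G (τ y) i j * r (τ y) + sch G i j (τ y) * s (τ y) with hE
    have e : (jac τ y).transpose * E * jac τ y = 0 := by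
      ext i j
      rw [conj_apply, Matrix.zero_apply, ← hp.hess_eq i j, h.hess_eq hy hs, h.sch_eq hy,
        h.eq_bf hy]
      simp only [bf, hE, Matrix.of_apply, Finset.sum_mul, ← Finset.sum_add_distrib]
      refine Finset.sum_congr rfl fun a _ => Finset.sum_congr rfl fun b _ => ?_
      ring
    have e0 : E = 0 := by
      have : (jac τ y).transpose⁻¹ * ((jac τ y).transpose * E * jac τ y) * (jac τ y)⁻¹ = E := by
        rw [mul_assoc (jac τ y).transpose, ← mul_assoc, Matrix.nonsing_inv_mul _ hu', one_mul,
          mul_assoc, Matrix.mul_nonsing_inv _ hu, mul_one]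
      rw [← this, e]
      simp
    intro i j
    exact congrFun (congrFun e0 i) j
  · set S : Matrix (Fin d) (Fin d) ℝ := .of fun p q => sch G p q (τ y) with hS
    have e1 : (Matrix.of fun p q => sch G' p q y) = (jac τ y).transpose * S * jac τ y := by
      ext a b
      rw [conj_apply, Matrix.of_apply, h.sch_eq hy]
    have e2 : (fun a => cpd a (fun z => r (τ z)) y)
        = (jac τ y).transpose.mulVec fun p => cpd p r (τ y) := by
      ext a
      rw [cpd_comp (hr _ hτU) (h.smooth y hy)]
      rfl
    have e3 : (fun a => cpd a (fun z => s (τ z)) y)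
        = (jac τ y).transpose.mulVec fun p => cpd p s (τ y) := by
      ext a
      rw [cpd_comp (hs _ hτU) (h.smooth y hy)]
      rfl
    have e4 : (fun a => cpd a (fun z => r (τ z)) y)
        = (Matrix.of fun p q => sch G' p q y).mulVec ((G' y)⁻¹.mulVec
          fun a => cpd a (fun z => s (τ z)) y) := by
      ext a
      rw [hp.cpd_eq a]
      rfl
    rw [e2, e3, e1, Matrix.mulVec_mulVec, Matrix.mulVec_mulVec, h.eq y hy, mul_assoc,
      mul_assoc (jac τ y).transpose S, mul_assoc (jac τ y).transpose, mul_assoc S,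
      ← mul_assoc (jac τ y), inv_conj (h.det_jac_ne hy), ← Matrix.mulVec_mulVec] at e4
    have e5 := Matrix.mulVec_injective_of_isUnit
      ((Matrix.isUnit_iff_isUnit_det _).2 hu') e4
    intro a
    have := congrFun e5 a
    rw [← Matrix.mulVec_mulVec] at this
    exact this

end IsPullback

namespace ParallelAt

variable {s r : Eu d → ℝ} (hp : ParallelAt G s r y) (hG : MetricOn G U) (hy : y ∈ U) (hd : 3 ≤ d)
include hp hG hy

/-- The derivative is `2 Hess s(∂_a, ∇s) + 2 r ∂_a s + 2 s ∂_a r`. The `g` part of the Hessian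
equation cancels the second term and its Schouten part cancels the third. -/
lemma cpd_norm (hs : ContDiffAt ℝ ∞ s y) (hr : ContDiffAt ℝ ∞ r y) (a : Fin d) :
    cpd a (fun z => bf (G z)⁻¹ (fun i => cpd i s z) (fun i => cpd i s z) + 2 * (s z * r z)) y
      = 0 := by
  have hm := fun i => cpd_smooth hs i
  have h1 : ContDiffAt ℝ ∞ (fun z => bf (G z)⁻¹ (fun i => cpd i s z) (fun i => cpd i s z)) y :=
    contDiffAt_bf (c := fun i j z => (G z)⁻¹ i j) (hG.smooth_inv hy) hm hm
  rw [cpd_add h1 (contDiffAt_const.mul (hs.mul hr)), cpd_mul contDiffAt_const (hs.mul hr),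
    cpd_const, cpd_mul hs hr, hG.cpd_normSq hy hs, hp.cpd_eq]
  have e : ∑ l, hess G s a l y * ∑ m, (G y)⁻¹ l m * cpd m s y
      = - (r y * ∑ l, G y a l * ∑ m, (G y)⁻¹ l m * cpd m s y)
        - s y * ∑ l, sch G a l y * ∑ m, (G y)⁻¹ l m * cpd m s y := by
    simp only [Finset.mul_sum (a := r y), Finset.mul_sum (a := s y), ← Finset.sum_neg_distrib,
      ← Finset.sum_sub_distrib]
    refine Finset.sum_congr rfl fun l _ => ?_
    linear_combination (∑ m, (G y)⁻¹ l m * cpd m s y) * hp.hess_eq a l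
  rw [e, hG.sum_mul_raise hy]
  ring

include hd

lemma laplacian : ∑ a, ∑ b, (G y)⁻¹ a b * hess G s a b y = - d * r y - schTrace G y * s y := by
  have e : ∑ a, ∑ b, ((G y)⁻¹ a b * hess G s a b y + r y * ((G y)⁻¹ a b * G y a b)
      + s y * ((G y)⁻¹ a b * sch G a b y)) = 0 := by
    refine Finset.sum_eq_zero fun a _ => Finset.sum_eq_zero fun b _ => ?_
    linear_combination (G y)⁻¹ a b * hp.hess_eq a b
  simp only [Finset.sum_add_distrib, ← Finset.mul_sum] at e
  rw [hG.sum_inv_mul_self hy, hG.trace_sch hy hd] at e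
  linear_combination e

/-- The metric `s⁻² g` is Einstein. -/
lemma ricc_rescale (hs : ∀ z ∈ U, ContDiffAt ℝ ∞ s z) (h0 : ∀ z ∈ U, s z ≠ 0) (i j : Fin d) :
    ricc (fun w => (s w ^ 2)⁻¹ • G w) i j y
      = -((d : ℝ) - 1) * (bf (G y)⁻¹ (fun i => cpd i s y) (fun i => cpd i s y) + 2 * (s y * r y))
        * ((s y ^ 2)⁻¹ * G y i j) := by
  have h3 : (3 : ℝ) ≤ d := by exact_mod_cast hd
  have h2 : (d : ℝ) - 2 ≠ 0 := by linarith
  have hsy := h0 y hy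
  have hh : hess G s i j y = - (G y i j * r y) - sch G i j y * s y := by
    linear_combination hp.hess_eq i j
  have hn : ∑ a, ∑ b, (G y)⁻¹ a b * (cpd a s y * cpd b s y)
      = bf (G y)⁻¹ (fun i => cpd i s y) (fun i => cpd i s y) :=
    Finset.sum_congr rfl fun a _ => Finset.sum_congr rfl fun b _ => by ring
  -- Here `(d-2)P` cancels against the Hessian and `J g` against the Laplacian, so only multiples of
  -- `g` survive.
  rw [hG.ricc_rescale hs h0 hy, hp.laplacian hG hy hd, hh, hn, sch]
  field_simp
  ring

end ParallelAt

end LocalTractor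

lemma ParallelAt.congr {d : ℕ} {G : Eu d → Matrix (Fin d) (Fin d) ℝ} {s s' r r' : Eu d → ℝ}
    {V : Set (Eu d)} {y : Eu d} (hV : IsOpen V) (hy : y ∈ V) (hs : ∀ z ∈ V, s z = s' z)
    (hr : ∀ z ∈ V, r z = r' z) (hp : ParallelAt G s r y) : ParallelAt G s' r' y := by
  have h1 : ∀ i, ∀ z ∈ V, cpd i s z = cpd i s' z := fun i z hz => cpd_congr_on hV hs hz i
  constructor
  · intro i j
    have := hp.hess_eq i j
    simp only [hess, h1 _ _ hy, hs y hy, hr y hy] at this ⊢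
    rwa [cpd_congr_on hV (h1 j) hy] at this
  · intro a
    have := hp.cpd_eq a
    simp only [h1 _ _ hy] at this
    rwa [cpd_congr_on hV hr hy] at this

/-! ### Constancy of `|I|²`, the identity `S = -|I|²`, and the Einstein equation. -/

section Global

variable {d : ℕ} {M : Type*} [TopologicalSpace M] [ChartedSpace (EuclideanSpace ℝ (Fin d)) M]
  [IsManifold (𝓡 d) ∞ M] {c : ConformalStructure d M} {I : TractorField c}

omit [IsManifold (𝓡 d) ∞ M] in
lemma inChart_trans (z x₀ : M) (f : M → ℝ) {y : Eu d} (hy : y ∈ overlap z x₀) :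
    inChart z f y = inChart x₀ f (trans z x₀ y) := by
  rw [trans, inChart_apply _ _ hy.2, inChart]

namespace IsAlmostEinstein

variable (hI : IsAlmostEinstein I) (g : c.Metric)
include hI

/-- The first slot of `∇I = 0`. It makes `μ` closed and leaves `σ` and `ρ` as the only unknowns. -/
lemma mu_eq (z : M) : I.mu g z = dform (I.sig g) z := by
  have hz : z ∈ (ch (d := d) z).source := mem_extChartAt_source z
  refine covector_ext z hz fun i => ?_
  have h := congrArg Prod.fst (hI.parallel g z i)
  rw [dform_frame z (hI.smooth g).1 hz]
  exact (sub_eq_zero.1 h).symm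

lemma mu_frame (x₀ : M) {z : M} (hz : z ∈ (ch (d := d) x₀).source) (i : Fin d) :
    I.mu g z (frame x₀ z i) = cpd i (inChart x₀ (I.sig g)) (ch x₀ z) := by
  rw [hI.mu_eq, dform_frame x₀ (hI.smooth g).1 hz]

omit hI in
lemma nablaForm_eq (α : FormField d M) (f : M → ℝ) (x : M) (hf : ContMDiff (𝓡 d) 𝓘(ℝ, ℝ) ∞ f)
    (hα : ∀ z, α z = dform f z) (i j : Fin d) :
    nablaForm g.field α x i j = hess (matChart g.1.inner x) (inChart x f) i j (ch x x) := by
  have hx : x ∈ (ch (d := d) x).source := mem_extChartAt_source x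
  have e : ∀ j, ∀ y ∈ (ch (d := d) x).target,
      inChart x (fun w => α w (frame x w j)) y = cpd j (inChart x f) y := by
    intro j y hy
    rw [inChart, hα, dform_frame x hf ((ch x).map_target hy), (ch x).right_inv hy]
  unfold nablaForm hess
  rw [pd_eq, cpd_congr_on (isOpen_ch_target x) (e j) (ch_mem_target x)]
  congr 1
  refine Finset.sum_congr rfl fun k _ => ?_
  rw [christoffel_eq _ _ _ _ _ hx, hα, dform_frame x hf hx]

omit hI in
lemma traceJ_eq (x : M) : traceJ g.field x = schTrace (matChart g.1.inner x) (ch x x) := by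
  simp only [traceJ, scalarCurv, schTrace, ricci_eq,
    matChart_apply g.1.inner x (mem_extChartAt_source (I := 𝓡 d) x)]

omit hI in
lemma schouten_eq (x : M) (i j : Fin d) :
    schouten g.field x i j = sch (matChart g.1.inner x) i j (ch x x) := by
  rw [schouten, sch, ricci_eq, traceJ_eq,
    matChart_apply g.1.inner x (mem_extChartAt_source (I := 𝓡 d) x)]

/-- `connection` is computed in the chart around `z`, so the equations come for free only at its
centre. -/
lemma parallelAt_self (z : M) : ParallelAt (matChart g.1.inner z) (inChart z (I.sig g))
    (inChart z (I.rho g)) (ch z z) := by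
  have hz : z ∈ (ch (d := d) z).source := mem_extChartAt_source z
  constructor
  · intro i j
    have h := congrFun (congrArg (fun t => t.2.1) (hI.parallel g z i)) j
    rw [matChart_apply _ _ hz, inChart_apply _ _ hz, inChart_apply _ _ hz, ← schouten_eq,
      ← nablaForm_eq g (I.mu g) (I.sig g) z (hI.smooth g).1 (hI.mu_eq g)]
    exact h
  · intro a
    have h := sub_eq_zero.1 (congrArg (fun t => t.2.2) (hI.parallel g z a))
    rw [pd_eq] at h
    rw [h]
    simp only [schouten_eq, hI.mu_frame g z hz, matChart_apply g.1.inner z hz, Finset.mul_sum]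

lemma smooth_sig (x₀ : M) : ∀ y ∈ (ch (d := d) x₀).target,
    ContDiffAt ℝ ∞ (inChart x₀ (I.sig g)) y :=
  fun _ hy => contDiffAt_inChart x₀ (hI.smooth g).1 hy

lemma smooth_rho (x₀ : M) : ∀ y ∈ (ch (d := d) x₀).target,
    ContDiffAt ℝ ∞ (inChart x₀ (I.rho g)) y :=
  fun _ hy => contDiffAt_inChart x₀ (hI.smooth g).2.2 hy

/-- The equations at the centre of the chart around `z` are carried by the transition map to the
chart around `x₀`; they can then be differentiated on its whole domain. -/
lemma parallelAt (x₀ : M) {y : Eu d} (hy : y ∈ (ch (d := d) x₀).target) :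
    ParallelAt (matChart g.1.inner x₀) (inChart x₀ (I.sig g)) (inChart x₀ (I.rho g)) y := by
  set z := (ch x₀).symm y with hz
  have hzs : z ∈ (ch (d := d) x₀).source := (ch x₀).map_target hy
  have hm := mem_overlap z x₀ hzs
  have h := (isPullback g.1 z x₀).parallelAt hm (hI.smooth_sig g x₀) (hI.smooth_rho g x₀)
    ((hI.parallelAt_self g z).congr (isOpen_overlap z x₀) hm
      (fun w hw => inChart_trans z x₀ _ hw) (fun w hw => inChart_trans z x₀ _ hw))
  rwa [trans_self_apply, hz, (ch x₀).right_inv hy] at h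

lemma norm_eq (x₀ : M) {z : M} (hz : z ∈ (ch (d := d) x₀).source) :
    tractorMetric (I z) (I z) = bf (matChart g.1.inner x₀ (ch (d := d) x₀ z))⁻¹
      (fun i => cpd i (inChart x₀ (I.sig g)) (ch (d := d) x₀ z))
      (fun i => cpd i (inChart x₀ (I.sig g)) (ch (d := d) x₀ z))
      + 2 * (inChart x₀ (I.sig g) (ch (d := d) x₀ z)
        * inChart x₀ (I.rho g) (ch (d := d) x₀ z)) := by
  rw [tractorMetric_eq _ _ g, formIn, coInner_eq g.1 x₀ hz, matChart_apply _ _ hz,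
    inChart_apply _ _ hz, inChart_apply _ _ hz]
  have : (fun i => ((I z).1 g).2.1 (frame x₀ z i))
      = fun i => cpd i (inChart x₀ (I.sig g)) (ch x₀ z) :=
    funext fun i => hI.mu_frame g x₀ hz i
  rw [this]
  change _ + I.sig g z * I.rho g z + I.rho g z * I.sig g z = _
  ring

/-- By `cpd_norm` the gradient vanishes in every chart, so the function is constant on coordinate
balls, hence locally constant on a preconnected space. -/
lemma exists_norm_eq [PreconnectedSpace M] : ∃ κ : ℝ, ∀ x, tractorMetric (I x) (I x) = κ := by
  have hl : IsLocallyConstant fun x => tractorMetric (I x) (I x) := by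
    rw [IsLocallyConstant.iff_eventually_eq]
    intro x
    have g := c.someMetric
    obtain ⟨ε, hε, hb⟩ := Metric.isOpen_iff.1 (isOpen_ch_target (d := d) x) _ (ch_mem_target x)
    set F : Eu d → ℝ := fun y => bf (matChart g.1.inner x y)⁻¹
      (fun i => cpd i (inChart x (I.sig g)) y) (fun i => cpd i (inChart x (I.sig g)) y)
      + 2 * (inChart x (I.sig g) y * inChart x (I.rho g) y) with hF
    have hsm : ∀ y ∈ (ch (d := d) x).target, ContDiffAt ℝ ∞ F y := by
      intro y hy
      have hm := fun i => cpd_smooth (hI.smooth_sig g x y hy) i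
      exact (contDiffAt_bf (c := fun i j z => (matChart g.1.inner x z)⁻¹ i j)
        ((metricOn g.1 x).smooth_inv hy) hm hm).add
        (contDiffAt_const.mul ((hI.smooth_sig g x y hy).mul (hI.smooth_rho g x y hy)))
    have h0 : ∀ y ∈ (ch (d := d) x).target, fderiv ℝ F y = 0 := by
      intro y hy
      ext v
      rw [fderiv_eq_sum_cpd]
      simp [hF, (hI.parallelAt g x hy).cpd_norm (metricOn g.1 x) hy (hI.smooth_sig g x y hy)
        (hI.smooth_rho g x y hy)]
    have hball : ∀ y ∈ Metric.ball (ch (d := d) x x) ε, F y = F (ch x x) := by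
      intro y hy
      refine (convex_ball _ _).is_const_of_fderivWithin_eq_zero (𝕜 := ℝ)
        (fun w hw => (smooth_differentiableAt (hsm w (hb hw))).differentiableWithinAt)
        (fun w hw => ?_) hy (Metric.mem_ball_self hε)
      rw [fderivWithin_of_isOpen Metric.isOpen_ball hw, h0 w (hb hw)]
    filter_upwards [(isOpen_ch_source (d := d) x).mem_nhds (mem_extChartAt_source x),
      (continuousAt_extChartAt (I := 𝓡 d) x).eventually (Metric.ball_mem_nhds _ hε)] with z hz hz'
    rw [hI.norm_eq g x hz, hI.norm_eq g x (mem_extChartAt_source x)]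
    exact hball _ hz'
  cases isEmpty_or_nonempty M with
  | inl h => exact ⟨0, fun x => (h.false x).elim⟩
  | inr h => exact ⟨_, fun x => hl.apply_eq_of_preconnectedSpace x h.some⟩

/-- In `(2/d) σ (Jσ + ∇^a∇_a σ)` the traced Hessian equation cancels `J` and leaves `-2σρ`. -/
lemma scaleCurv_eq (hd : 3 ≤ d) (x : M) :
    scaleCurv g.field (I.sig g) x = - tractorMetric (I x) (I x) := by
  have hx : x ∈ (ch (d := d) x).source := mem_extChartAt_source x
  have h3 : (3 : ℝ) ≤ d := by exact_mod_cast hd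
  have hd0 : (d : ℝ) ≠ 0 := by linarith
  have hl := (hI.parallelAt_self g x).laplacian (metricOn g.1 x) (ch_mem_target x) hd
  rw [matChart_apply _ _ hx, inChart_apply _ _ hx, inChart_apply _ _ hx] at hl
  unfold scaleCurv
  simp only [nablaForm_eq g (dform (I.sig g)) (I.sig g) x (hI.smooth g).1 (fun _ => rfl),
    traceJ_eq]
  have hl' : ∑ i, ∑ j, (coeff g.field x x)⁻¹ i j * hess (matChart g.1.inner x)
      (inChart x (I.sig g)) i j (ch x x) = _ := hl
  rw [hl', tractorMetric_eq _ _ g, formIn, ← hI.mu_eq]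
  change 2 / (d : ℝ) * I.sig g x * _ - coInner g.1.inner x (I.mu g x) (I.mu g x)
    = -(coInner g.1.inner x (I.mu g x) (I.mu g x) + I.sig g x * I.rho g x
      + I.rho g x * I.sig g x)
  field_simp
  ring

-- The first slot only changes by the positive factor `e^φ`, so one scale detects `Σ`.
omit hI in
lemma mem_singularSet (x : M) : x ∈ I.singularSet ↔ I.sig g x = 0 := by
  refine ⟨fun h => h g, fun h g' => ?_⟩
  obtain ⟨φ, hφ⟩ : ∃ φ, IsRescaling g.1 g'.1 φ :=
    Quotient.exact (s := conformalSetoid d M) (g.2.trans g'.2.symm)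
  change ((I x).1 g').1 = 0
  rw [(I x).2 g g' φ hφ]
  change Real.exp (φ x) * I.sig g x = 0
  rw [h, mul_zero]

/-- The singular metric is Einstein where it is defined. -/
lemma ricci_singularMetric (hd : 3 ≤ d) {x : M} (hx : x ∉ I.singularSet) (i j : Fin d) :
    ricci (I.singularMetric g) x i j
      = -((d : ℝ) - 1) * tractorMetric (I x) (I x) * coeff (I.singularMetric g) x x i j := by
  have hxs : x ∈ (ch (d := d) x).source := mem_extChartAt_source x
  rw [mem_singularSet g] at hx
  -- The rescaling formula needs an open set on which `σ` has no zeros, so the chart domain is cut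
  -- down.
  set U : Set (Eu d) := (ch (d := d) x).target ∩ (inChart x (I.sig g)) ⁻¹' {0}ᶜ with hU
  have hUo : IsOpen U := ContinuousOn.isOpen_inter_preimage
    (fun y hy => (hI.smooth_sig g x y hy).continuousAt.continuousWithinAt)
    (isOpen_ch_target x) isOpen_compl_singleton
  have hxU : ch x x ∈ U := ⟨ch_mem_target x, by
    rw [mem_preimage, inChart_apply _ _ hxs]
    exact hx⟩
  have hm : matChart (I.singularMetric g) x
      = fun w => (inChart x (I.sig g) w ^ 2)⁻¹ • matChart g.1.inner x w := rfl
  have hG := (metricOn g.1 x).mono hUo inter_subset_left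
  rw [ricci_eq, hm, (hI.parallelAt_self g x).ricc_rescale hG hxU hd
    (fun y hy => hI.smooth_sig g x y hy.1) (fun y hy => hy.2), hI.norm_eq g x hxs,
    ← matChart_apply (I.singularMetric g) x hxs, hm]
  rfl

lemma scalarCurv_singularMetric (hd : 3 ≤ d) {x : M} (hx : x ∉ I.singularSet) :
    scalarCurv (I.singularMetric g) x
      = -((d : ℝ) - 1) * tractorMetric (I x) (I x) * d := by
  have hxs : x ∈ (ch (d := d) x).source := mem_extChartAt_source x
  have hx' := hx
  rw [mem_singularSet g] at hx'
  have hm : coeff (I.singularMetric g) x x = (I.sig g x ^ 2)⁻¹ • coeff g.1.inner x x := rfl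
  have hk : (I.sig g x ^ 2)⁻¹ ≠ 0 := inv_ne_zero (pow_ne_zero 2 hx')
  have ht := (metricOn g.1 x).sum_inv_mul_self (ch_mem_target x)
  rw [matChart_apply _ _ hxs] at ht
  unfold scalarCurv
  simp only [hI.ricci_singularMetric g hd hx, hm, inv_smul_matrix _ hk]
  rw [← ht]
  simp only [Finset.mul_sum, Matrix.smul_apply, smul_eq_mul]
  refine Finset.sum_congr rfl fun a _ => Finset.sum_congr rfl fun b _ => ?_
  field_simp

end IsAlmostEinstein

end Global

/-! ### A parallel tractor is determined by its value at one point. -/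

/-- Unique continuation for solutions of first-order systems of differential inequalities. -/
lemma eventually_eq_zero_of_cpd_isBigO {d : ℕ} {ι : Type*} [Fintype ι] {f : ι → Eu d → ℝ}
    {U : Set (Eu d)} {y₀ : Eu d} (hU : U ∈ 𝓝 y₀) (hf : ∀ m, ∀ y ∈ U, ContDiffAt ℝ ∞ (f m) y)
    (h0 : ∀ m, f m y₀ = 0)
    (hO : ∀ m i, cpd i (f m) =O[𝓝 y₀] fun y => fun m => f m y) :
    ∀ᶠ y in 𝓝 y₀, ∀ m, f m y = 0 := by
  have hO' : (fun y => fun (p : ι × Fin d) => cpd p.2 (f p.1) y)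
      =O[𝓝 y₀] fun y => fun m => f m y := Asymptotics.isBigO_pi.2 fun p => hO p.1 p.2
  obtain ⟨C, hC⟩ := hO'.bound
  obtain ⟨ε, hε, hb⟩ := Metric.mem_nhds_iff.1 (inter_mem hU hC)
  filter_upwards [Metric.ball_mem_nhds y₀ hε] with y hy
  set v := y - y₀ with hv
  have hmem : ∀ t ∈ Icc (0 : ℝ) 1, y₀ + t • v ∈ Metric.ball y₀ ε := by
    intro t ht
    rw [mem_ball_iff_norm] at hy ⊢
    rw [add_sub_cancel_left, norm_smul, Real.norm_of_nonneg ht.1]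
    exact (mul_le_of_le_one_left (norm_nonneg _) ht.2).trans_lt hy
  have hder : ∀ t ∈ Icc (0 : ℝ) 1, HasDerivAt (fun t => fun m => f m (y₀ + t • v))
      (fun m => ∑ i, v i * cpd i (f m) (y₀ + t • v)) t := by
    intro t ht
    refine hasDerivAt_pi.2 fun m => ?_
    have hl : HasDerivAt (fun t : ℝ => y₀ + t • v) v t := by
      simpa using ((hasDerivAt_id t).smul_const v).const_add y₀
    have := (smooth_differentiableAt (hf m _ (hb (hmem t ht)).1)).hasFDerivAt.comp_hasDerivAt t hl
    rwa [fderiv_eq_sum_cpd] at this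
  -- Grönwall's inequality on the segment from `y₀` to `y`. The constant `C` bounds all partial
  -- derivatives by the size of `f`, and the velocity `v` contributes its `ℓ¹` norm.
  have key := eq_zero_of_abs_deriv_le_mul_abs_self_of_eq_zero_right
    (f := fun t : ℝ => fun m => f m (y₀ + t • v)) (K := (∑ i, |v i|) * C) (a := 0) (b := 1)
    (fun t ht => (hder t ht).continuousAt.continuousWithinAt)
    (fun t ht => (hder t (Ico_subset_Icc_self ht)).hasDerivWithinAt)
    (by ext m; simp [h0]) (fun t ht => ?_) 1 (by simp)
  · intro m
    have := congrFun key m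
    simpa [hv] using this
  · have hB := (hb (hmem t (Ico_subset_Icc_self ht))).2
    rw [mem_ofPred_eq] at hB
    -- `C` itself is not known to be nonnegative, but its product with the norm of `f` is, being an
    -- upper bound for a norm.
    have hnn := (norm_nonneg _).trans hB
    rw [mul_assoc]
    refine (pi_norm_le_iff_of_nonneg (mul_nonneg (Finset.sum_nonneg fun i _ => abs_nonneg _)
      hnn)).2 fun m => ?_
    rw [Finset.sum_mul]
    refine (norm_sum_le _ _).trans (Finset.sum_le_sum fun i _ => ?_)
    rw [norm_mul, Real.norm_eq_abs]
    refine mul_le_mul_of_nonneg_left ?_ (abs_nonneg _)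
    exact (norm_le_pi_norm (fun p : ι × Fin d => cpd p.2 (f p.1) (y₀ + t • v)) (m, i)).trans hB

/-- The components `(s, r, ∂s)` of a tractor in coordinates. -/
def tractorComp {d : ℕ} (s r : Eu d → ℝ) : Option (Option (Fin d)) → Eu d → ℝ
  | none => s
  | some none => r
  | some (some i) => cpd i s

/-- A parallel tractor that vanishes at a point vanishes nearby. -/
lemma ParallelAt.eventually_eq_zero {d : ℕ} {G : Eu d → Matrix (Fin d) (Fin d) ℝ}
    {s r : Eu d → ℝ} {U : Set (Eu d)} {y₀ : Eu d} (hG : MetricOn G U) (hy : y₀ ∈ U)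
    (hp : ∀ y ∈ U, ParallelAt G s r y) (hs : ∀ y ∈ U, ContDiffAt ℝ ∞ s y)
    (hr : ∀ y ∈ U, ContDiffAt ℝ ∞ r y) (h0 : ∀ m, tractorComp s r m y₀ = 0) :
    ∀ᶠ y in 𝓝 y₀, ∀ m, tractorComp s r m y = 0 := by
  have hn := hG.isOpen.mem_nhds hy
  refine eventually_eq_zero_of_cpd_isBigO hn ?_ h0 ?_
  · rintro (_ | _ | i) y hy
    · exact hs y hy
    · exact hr y hy
    · exact cpd_smooth (hs y hy) i
  have hself : ∀ m, tractorComp s r m =O[𝓝 y₀] fun y => fun m => tractorComp s r m y :=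
    Asymptotics.isBigO_pi.1 (Asymptotics.isBigO_refl _ _)
  have hmul : ∀ {a b : Eu d → ℝ}, ContDiffAt ℝ ∞ a y₀ →
      (b =O[𝓝 y₀] fun y => fun m => tractorComp s r m y) →
      (fun y => a y * b y) =O[𝓝 y₀] fun y => fun m => tractorComp s r m y := by
    intro a b ha hb
    have := (ha.continuousAt.isBigO_one ℝ).mul hb.norm_right
    simp only [one_mul] at this
    exact this.of_norm_right
  have hs' : s =O[𝓝 y₀] fun y => fun m => tractorComp s r m y := hself none
  have hr' : r =O[𝓝 y₀] fun y => fun m => tractorComp s r m y := hself (some none)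
  have hc' : ∀ i, cpd i s =O[𝓝 y₀] fun y => fun m => tractorComp s r m y :=
    fun i => hself (some (some i))
  -- The system is closed: each derivative of `s`, `r` and `∂s` is a combination of these same
  -- functions with coefficients continuous at `y₀`.
  rintro (_ | _ | j) i
  · exact hc' i
  · have e : (fun y => ∑ b, sch G i b y * ∑ e, (G y)⁻¹ b e * cpd e s y) =ᶠ[𝓝 y₀] cpd i r :=
      eventually_of_mem hn fun y hy => ((hp y hy).cpd_eq i).symm
    refine Asymptotics.IsBigO.congr' ?_ e EventuallyEq.rfl
    exact .fun_sum fun b _ => hmul (hG.smooth_sch hy i b)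
      (.fun_sum fun e _ => hmul (hG.smooth_inv hy b e) (hc' e))
  · have e : (fun y => (∑ k, chr G k i j y * cpd k s y) - G y i j * r y - sch G i j y * s y)
        =ᶠ[𝓝 y₀] cpd i (cpd j s) :=
      eventually_of_mem hn fun y hy => by
        have := (hp y hy).hess_eq i j
        rw [hess] at this
        linear_combination -this
    refine Asymptotics.IsBigO.congr' ?_ e EventuallyEq.rfl
    exact ((Asymptotics.IsBigO.fun_sum fun k _ => hmul (hG.smooth_chr hy k i j) (hc' k)).sub
      (hmul (hG.smooth y₀ hy i j) hr')).sub (hmul (hG.smooth_sch hy i j) hs')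

section Global

variable {d : ℕ} {M : Type*} [TopologicalSpace M] [ChartedSpace (EuclideanSpace ℝ (Fin d)) M]
  [IsManifold (𝓡 d) ∞ M] {c : ConformalStructure d M} {I : TractorField c}

namespace IsAlmostEinstein

variable (hI : IsAlmostEinstein I) (g : c.Metric)
include hI

lemma comp_eq_zero_iff (x₀ : M) {z : M} (hz : z ∈ (ch (d := d) x₀).source) :
    (I z).1 g = 0 ↔ ∀ m, tractorComp (inChart x₀ (I.sig g)) (inChart x₀ (I.rho g)) m
      (ch (d := d) x₀ z) = 0 := by
  have hs : inChart x₀ (I.sig g) (ch (d := d) x₀ z) = ((I z).1 g).1 := inChart_apply _ _ hz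
  have hr : inChart x₀ (I.rho g) (ch (d := d) x₀ z) = ((I z).1 g).2.2 := inChart_apply _ _ hz
  have hm : ∀ i, ((I z).1 g).2.1 (frame x₀ z i)
      = cpd i (inChart x₀ (I.sig g)) (ch (d := d) x₀ z) := hI.mu_frame g x₀ hz
  constructor
  · rintro h (_ | _ | i)
    · exact hs.trans (by rw [h]; rfl)
    · exact hr.trans (by rw [h]; rfl)
    · exact (hm i).symm.trans (by rw [h]; rfl)
  · intro h
    refine Prod.ext (hs.symm.trans (h none)) (Prod.ext ?_ (hr.symm.trans (h (some none))))
    exact covector_ext x₀ hz fun i => (hm i).trans (h (some (some i)))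

/-- A parallel tractor field that is not identically zero vanishes nowhere. -/
lemma apply_ne_zero [PreconnectedSpace M] (x : M) : (I x).1 g ≠ 0 := by
  have hcont : ∀ (x : M) m, ContinuousAt (fun z => tractorComp (inChart x (I.sig g))
      (inChart x (I.rho g)) m (ch (d := d) x z)) x := by
    intro x m
    refine ContinuousAt.comp (f := ch (d := d) x) ?_ (continuousAt_extChartAt x)
    rcases m with _ | _ | i
    · exact (hI.smooth_sig g x _ (ch_mem_target x)).continuousAt
    · exact (hI.smooth_rho g x _ (ch_mem_target x)).continuousAt
    · exact (cpd_smooth (hI.smooth_sig g x _ (ch_mem_target x)) i).continuousAt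
  have hsrc : ∀ x : M, ∀ᶠ z in 𝓝 x, z ∈ (ch (d := d) x).source := fun x =>
    (isOpen_ch_source x).mem_nhds (mem_extChartAt_source x)
  -- Closed by continuity of the components, open by unique continuation; connectedness then leaves
  -- the empty set or everything.
  have hclopen : IsClopen {x | (I x).1 g = 0} := by
    constructor
    · rw [← isOpen_compl_iff, isOpen_iff_mem_nhds]
      intro x hx
      have hx' : ¬ (I x).1 g = 0 := hx
      rw [hI.comp_eq_zero_iff g x (mem_extChartAt_source x), not_forall] at hx'
      obtain ⟨m, hm⟩ := hx'
      filter_upwards [(hcont x m).eventually_ne hm, hsrc x] with z hz hzs h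
      exact hz ((hI.comp_eq_zero_iff g x hzs).1 h m)
    · rw [isOpen_iff_mem_nhds]
      intro x hx
      have hx' : (I x).1 g = 0 := hx
      rw [hI.comp_eq_zero_iff g x (mem_extChartAt_source x)] at hx'
      have h := ParallelAt.eventually_eq_zero (metricOn g.1 x) (ch_mem_target x)
        (fun y hy => hI.parallelAt g x hy) (hI.smooth_sig g x) (hI.smooth_rho g x) hx'
      filter_upwards [(continuousAt_extChartAt (I := 𝓡 d) x).eventually h, hsrc x] with z hz hzs
      exact (hI.comp_eq_zero_iff g x hzs).2 hz
  intro hx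
  obtain ⟨z, hz⟩ := hI.ne_zero
  rcases isClopen_iff.1 hclopen with h | h
  · exact h.subset hx
  · refine hz (Subtype.ext (funext fun g' => ?_))
    obtain ⟨φ, hφ⟩ : ∃ φ, IsRescaling g.1 g'.1 φ :=
      Quotient.exact (s := conformalSetoid d M) (g.2.trans g'.2.symm)
    have hz0 : (I z).1 g = 0 := h.symm.subset (mem_univ z)
    rw [(I z).2 g g' φ hφ, hz0]
    -- That `changeScale` fixes zero is read off from the zero tractor.
    exact ((0 : Tractor c z).2 g g' φ hφ).symm

end IsAlmostEinstein

end Global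

/-! ### Nondegenerate critical zeros, and straightening a function with nonzero differential. -/

section Local

variable {d : ℕ}

/-- Near a zero of a parallel tractor's first two slots, the middle slot does not vanish again. -/
lemma ParallelAt.eventually_cpd_ne {G : Eu d → Matrix (Fin d) (Fin d) ℝ} {s r : Eu d → ℝ}
    {U : Set (Eu d)} {y₀ : Eu d} (hp : ParallelAt G s r y₀) (hG : MetricOn G U) (hy : y₀ ∈ U)
    (hs : ContDiffAt ℝ ∞ s y₀) (h0 : s y₀ = 0) (h1 : ∀ i, cpd i s y₀ = 0) (hr : r y₀ ≠ 0) :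
    ∀ᶠ y in 𝓝[≠] y₀, ∃ i, cpd i s y ≠ 0 := by
  have hd : HasFDerivAt (fun y => fun i => cpd i s y)
      (ContinuousLinearMap.pi fun i => fderiv ℝ (cpd i s) y₀) y₀ :=
    hasFDerivAt_pi.2 fun i => (smooth_differentiableAt (cpd_smooth hs i)).hasFDerivAt
  have hh : ∀ i j, cpd j (cpd i s) y₀ = - (G y₀ j i * r y₀) := by
    intro i j
    have := hp.hess_eq j i
    simp only [hess, h0, h1, mul_zero, Finset.sum_const_zero] at this
    linear_combination this
  -- The derivative of `y ↦ ds` at `y₀` is `-r g`, injective because `r ≠ 0` and `g` is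
  -- nondegenerate. In finite dimension it is then bounded below, so `ds` cannot vanish at nearby
  -- points other than `y₀`.
  have hinj : LinearMap.ker (ContinuousLinearMap.pi fun i => fderiv ℝ (cpd i s) y₀).toLinearMap
      = ⊥ := by
    rw [LinearMap.ker_eq_bot']
    intro v hv
    have h2 : (G y₀).mulVec (fun i => v i) = 0 := by
      ext i
      have h3 : fderiv ℝ (cpd i s) y₀ v = 0 := congrFun hv i
      rw [fderiv_eq_sum_cpd] at h3
      simp only [hh] at h3
      have h4 : r y₀ * ∑ j, G y₀ i j * v j = 0 := by
        rw [Finset.mul_sum, ← neg_eq_zero, ← h3, ← Finset.sum_neg_distrib]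
        exact Finset.sum_congr rfl fun j _ => by rw [hG.symm y₀ i j]; ring
      exact (mul_eq_zero.1 h4).resolve_left hr
    have h3 := Matrix.eq_zero_of_mulVec_eq_zero (hG.det_ne y₀ hy) h2
    ext i
    exact congrFun h3 i
  obtain ⟨K, -, hK⟩ := LinearMap.exists_antilipschitzWith _ hinj
  filter_upwards [hd.eventually_ne (c := 0) ⟨K, hK⟩] with y hne
  by_contra! hc
  exact hne (funext hc)

/-- The map replacing the `i`-th coordinate by the function `s`. -/
def replaceCoord (s : Eu d → ℝ) (i : Fin d) (y : Eu d) : Eu d := y + (s y - y i) • ev i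

lemma replaceCoord_apply (s : Eu d → ℝ) (i : Fin d) (y : Eu d) : replaceCoord s i y i = s y := by
  simp [replaceCoord, ev]

lemma contDiffAt_replaceCoord {s : Eu d → ℝ} {y : Eu d} (hs : ContDiffAt ℝ ∞ s y) (i : Fin d) :
    ContDiffAt ℝ ∞ (replaceCoord s i) y :=
  contDiffAt_id.add ((hs.sub (contDiffAt_coord contDiffAt_id i)).smul contDiffAt_const)

/-- The input for the inverse function theorem. For `v` in the kernel, the `i`-th component gives
`ds(v) = 0`; then `v = v_i ∂_i`, and `v_i ∂_i s = 0` forces `v = 0`. -/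
lemma hasFDerivAt_replaceCoord {s : Eu d → ℝ} {y : Eu d} (hs : ContDiffAt ℝ ∞ s y) {i : Fin d}
    (hi : cpd i s y ≠ 0) :
    ∃ L : Eu d ≃L[ℝ] Eu d, HasFDerivAt (replaceCoord s i) (L : Eu d →L[ℝ] Eu d) y := by
  set A : Eu d →L[ℝ] Eu d := ContinuousLinearMap.id ℝ (Eu d)
    + (fderiv ℝ s y - EuclideanSpace.proj i).smulRight (ev i) with hA
  have hd : HasFDerivAt (replaceCoord s i) A y :=
    (hasFDerivAt_id y).add (((smooth_differentiableAt hs).hasFDerivAt.sub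
      (EuclideanSpace.proj (𝕜 := ℝ) i).hasFDerivAt).smul_const (ev i))
  have hinj : Function.Injective A.toLinearMap := by
    rw [injective_iff_map_eq_zero]
    intro v hv
    have hv' : v + (fderiv ℝ s y v - v i) • ev i = 0 := hv
    have h1 : fderiv ℝ s y v = 0 := by
      have := congrArg (fun w : Eu d => w i) hv'
      simpa [ev] using this
    have h2 : v = v i • ev i := by
      rw [h1, zero_sub, neg_smul, ← sub_eq_add_neg] at hv'
      exact sub_eq_zero.1 hv'
    have h3 : v i * cpd i s y = 0 := by
      rw [h2, map_smul] at h1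
      exact h1
    rw [h2, (mul_eq_zero.1 h3).resolve_right hi, zero_smul]
  refine ⟨(LinearEquiv.ofInjectiveEndo A.toLinearMap hinj).toContinuousLinearEquiv, ?_⟩
  convert hd using 1
  ext v
  rfl

end Local

/-! ### Regular level sets and the mean curvature of an umbilic conormal. -/

section Charts

variable {d : ℕ} {M : Type*} [TopologicalSpace M] [ChartedSpace (EuclideanSpace ℝ (Fin d)) M]
  [IsManifold (𝓡 d) ∞ M]

/-- A smooth function with non-zero differential is locally a coordinate. -/
lemma exists_chart_coord {f : M → ℝ} (hf : ContMDiff (𝓡 d) 𝓘(ℝ, ℝ) ∞ f) (p : M) (i : Fin d)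
    (hi : cpd i (inChart p f) (ch p p) ≠ 0) :
    ∃ e ∈ IsManifold.maximalAtlas (𝓡 d) ∞ M, p ∈ e.source ∧ ∀ q ∈ e.source, e q i = f q := by
  have hs := fun y hy => contDiffAt_inChart p hf (y := y) hy
  set s := inChart (d := d) p f with hsdef
  -- Restricting to `∂_i s ≠ 0` makes the derivative invertible at every point of the new chart, so
  -- the inverse is smooth throughout and not just at the image of `p`.
  set W : Set (Eu d) := (ch (d := d) p).target ∩ (cpd i s) ⁻¹' {0}ᶜ with hW
  have hWo : IsOpen W := ContinuousOn.isOpen_inter_preimage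
    (fun y hy => (cpd_smooth (hs y hy) i).continuousAt.continuousWithinAt)
    (isOpen_ch_target p) isOpen_compl_singleton
  have hpW : ch p p ∈ W := ⟨ch_mem_target p, hi⟩
  obtain ⟨L, hL⟩ := hasFDerivAt_replaceCoord (hs _ hpW.1) hpW.2
  set Φ := (contDiffAt_replaceCoord (hs _ hpW.1) i).toOpenPartialHomeomorph _ hL (by simp)
    with hΦ
  have hΦc : ∀ y, Φ y = replaceCoord s i y := fun y => rfl
  set Ψ := Φ.restrOpen W hWo with hΨ
  have hΨs : Ψ.source = Φ.source ∩ W := Φ.restrOpen_source W hWo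
  have hΨc : ∀ y, Ψ y = replaceCoord s i y := fun y => rfl
  have hpΨ : ch p p ∈ Ψ.source := by
    rw [hΨs]
    exact ⟨ContDiffAt.mem_toOpenPartialHomeomorph_source _ _ _, hpW⟩
  have h1 : ContMDiffOn (𝓡 d) (𝓡 d) ∞ Ψ Ψ.source := by
    intro y hy
    rw [hΨs] at hy
    exact (contMDiffAt_iff_contDiffAt.2
      (contDiffAt_replaceCoord (hs y hy.2.1) i)).contMDiffWithinAt
  have h2 : ContMDiffOn (𝓡 d) (𝓡 d) ∞ Ψ.symm Ψ.target := by
    intro y hy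
    have hy' := Ψ.map_target hy
    rw [hΨs] at hy'
    obtain ⟨L', hL'⟩ := hasFDerivAt_replaceCoord (hs _ hy'.2.1) hy'.2.2
    exact (contMDiffAt_iff_contDiffAt.2 (Ψ.contDiffAt_symm hy hL'
      (contDiffAt_replaceCoord (hs _ hy'.2.1) i))).contMDiffWithinAt
  have hc := IsManifold.chart_mem_maximalAtlas (I := 𝓡 d) (n := ∞) p
  have hc1 := contMDiffOn_of_mem_maximalAtlas hc
  have hc2 := contMDiffOn_symm_of_mem_maximalAtlas hc
  refine ⟨(chartAt (Eu d) p).trans Ψ, ?_, ?_, ?_⟩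
  · refine OpenPartialHomeomorph.mem_maximalAtlas_of_contMDiffOn _ ?_ ?_
    · rw [OpenPartialHomeomorph.coe_trans, OpenPartialHomeomorph.trans_source]
      exact h1.comp (hc1.mono inter_subset_left) fun q hq => hq.2
    · rw [OpenPartialHomeomorph.coe_trans_symm, OpenPartialHomeomorph.trans_target]
      exact hc2.comp (h2.mono inter_subset_left) fun q hq => hq.2
  · rw [OpenPartialHomeomorph.trans_source]
    exact ⟨mem_chart_source _ p, hpΨ⟩
  · intro q hq
    rw [OpenPartialHomeomorph.trans_source] at hq
    rw [OpenPartialHomeomorph.coe_trans, Function.comp_apply, hΨc, replaceCoord_apply]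
    exact inChart_apply p f (by simpa using hq.1)

/-- Tangent vectors of a level set are annihilated by the differential of the function. -/
lemma sum_cpd_eq_zero_of_mem_tangentVectors {f : M → ℝ} (hf : ContMDiff (𝓡 d) 𝓘(ℝ, ℝ) ∞ f)
    {S : Set M} (hS : ∀ q ∈ S, f q = 0) {q : M} {v : Eu d} (hv : v ∈ tangentVectors S q) :
    ∑ i, v i * cpd i (inChart q f) (ch q q) = 0 := by
  obtain ⟨γ, hγ, h0, hγS, hder⟩ := hv
  have hs := contDiffAt_inChart q hf (ch_mem_target q)
  rw [← fderiv_eq_sum_cpd]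
  have h1 := (smooth_differentiableAt hs).hasFDerivAt
  rw [← h0] at h1 hder ⊢
  have h2 := h1.comp_hasDerivAt (0 : ℝ) hder
  have h3 : (inChart (d := d) (γ 0) f ∘ fun t => ch (d := d) (γ 0) (γ t))
      =ᶠ[𝓝 0] fun _ => (0 : ℝ) := by
    filter_upwards [hγS, hγ.continuousAt.eventually
      ((isOpen_ch_source (d := d) (γ 0)).mem_nhds (mem_extChartAt_source (γ 0)))] with t ht ht'
    rw [Function.comp_apply, inChart_apply _ _ ht', hS _ ht]
  exact (h2.congr_of_eventuallyEq h3.symm).unique (hasDerivAt_const _ _)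

-- For multiplication by a real constant no differentiability is needed: `fderiv` takes compatible
-- default values. Hence `nablaForm_smul` holds for arbitrary fields.
omit [IsManifold (𝓡 d) ∞ M] in
lemma pd_const_mul (x₀ z : M) (i : Fin d) (k : ℝ) (f : M → ℝ) :
    pd x₀ i (fun w => k * f w) z = k * pd x₀ i f z := by
  have := congrFun (fderiv_const_smul_field (𝕜 := ℝ)
    (f := fun y => f ((extChartAt (𝓡 d) x₀).symm y)) k) (extChartAt (𝓡 d) x₀ z)
  have := congrArg (fun L : Eu d →L[ℝ] ℝ => L (ev i)) this
  exact this

lemma nablaForm_smul (g : BilinField d M) (k : ℝ) (α : FormField d M) (x : M) (i j : Fin d) :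
    nablaForm g (fun z => k • α z) x i j = k * nablaForm g α x i j := by
  unfold nablaForm
  simp only [smul_apply, smul_eq_mul]
  rw [pd_const_mul, mul_sub, Finset.mul_sum]
  congr 1
  exact Finset.sum_congr rfl fun l _ => by ring

lemma coInner_smul_smul (g : SmoothMetric d M) (x : M) (k : ℝ)
    (α : TangentSpace (𝓡 d) x →L[ℝ] ℝ) :
    coInner g.inner x (k • α) (k • α) = k ^ 2 * coInner g.inner x α α := by
  rw [coInner_smul_right, coInner_comm, coInner_smul_right]
  ring

/-- The mean curvature for a unit conormal whose derivative is pure trace. -/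
lemma meanCurv_of_nablaForm_eq (hd : 3 ≤ d) (g : SmoothMetric d M) (ν : FormField d M) (x : M)
    (H : ℝ) (h1 : coInner g.inner x (ν x) (ν x) = 1)
    (hν : ∀ a b, nablaForm g.inner ν x a b = H * coeff g.inner x x a b) :
    meanCurv g.inner ν x = H := by
  have hx : x ∈ (ch (d := d) x).source := mem_extChartAt_source x
  have h3 : (3 : ℝ) ≤ d := by exact_mod_cast hd
  have h2 : (d : ℝ) - 1 ≠ 0 := by linarith
  have hG := metricOn g x
  have ht := hG.sum_inv_mul_self (ch_mem_target x)
  have hr := hG.sum_mul_raise (ch_mem_target x) fun m => ν x (frame x x m)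
  rw [matChart_apply _ _ hx] at ht hr
  have hn : ∑ a, ∑ b, raise g.inner ν x a * raise g.inner ν x b * coeff g.inner x x a b = 1 := by
    rw [← h1]
    have : ∀ a, ∑ b, raise g.inner ν x a * raise g.inner ν x b * coeff g.inner x x a b
        = raise g.inner ν x a * ν x (frame x x a) := by
      intro a
      rw [← hr a, Finset.mul_sum]
      exact Finset.sum_congr rfl fun b _ => by rw [raise, raise]; ring
    simp only [this]
    simp only [raise, coInner, Finset.sum_mul]
    exact Finset.sum_congr rfl fun a _ => Finset.sum_congr rfl fun b _ => by ring
  -- `g⁻¹ - ν⊗ν` contracted with `H g` gives `H (d - 1)`, which the normalisation of `meanCurv`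
  -- divides out.
  have e : ∑ a, ∑ b, ((coeff g.inner x x)⁻¹ a b - raise g.inner ν x a * raise g.inner ν x b)
      * nablaForm g.inner ν x a b
      = H * (∑ a, ∑ b, (coeff g.inner x x)⁻¹ a b * coeff g.inner x x a b
        - ∑ a, ∑ b, raise g.inner ν x a * raise g.inner ν x b * coeff g.inner x x a b) := by
    simp only [hν, Finset.mul_sum, ← Finset.sum_sub_distrib]
    exact Finset.sum_congr rfl fun a _ => Finset.sum_congr rfl fun b _ => by ring
  rw [meanCurv, e, ht, hn]
  field_simp

end Charts

/-! ### Geometry of the scale singularity set. -/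

section Global

variable {d : ℕ} {M : Type*} [TopologicalSpace M] [ChartedSpace (EuclideanSpace ℝ (Fin d)) M]
  [IsManifold (𝓡 d) ∞ M] {c : ConformalStructure d M} {I : TractorField c}

namespace IsAlmostEinstein

variable (hI : IsAlmostEinstein I) (g : c.Metric)

/-- The pivot of the trichotomy: on `Σ` the sign of `|I|²` decides between no zeros, critical zeros
and regular zeros of `σ`. -/
lemma tractorMetric_of_mem {p : M} (hp : p ∈ I.singularSet) :
    tractorMetric (I p) (I p) = coInner g.1.inner p (I.mu g p) (I.mu g p) := by
  have h0 : ((I p).1 g).1 = 0 := hp g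
  rw [tractorMetric_eq _ _ g, formIn, h0, zero_mul, mul_zero, add_zero, add_zero]
  rfl

include hI

/-- At the zeros of `σ` the one-form `μ` satisfies `∇ μ = - ρ g`. -/
lemma nablaForm_mu_of_mem {p : M} (hp : p ∈ I.singularSet) (a b : Fin d) :
    nablaForm g.field (I.mu g) p a b = - I.rho g p * coeff g.field p p a b := by
  have h0 : I.sig g p = 0 := hp g
  have h : nablaForm g.field (I.mu g) p a b + coeff g.field p p a b * I.rho g p
      + schouten g.field p a b * I.sig g p = 0 :=
    congrFun (congrArg (fun t => t.2.1) (hI.parallel g p a)) b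
  rw [h0, mul_zero, add_zero] at h
  linear_combination h

lemma nablaForm_smul_mu_of_mem (k : ℝ) {p : M} (hp : p ∈ I.singularSet) (a b : Fin d) :
    nablaForm g.field (fun x => k • I.mu g x) p a b
      = - (k * I.rho g p) * coeff g.field p p a b := by
  rw [nablaForm_smul, hI.nablaForm_mu_of_mem g hp]
  ring

lemma cpd_sig_eq_zero_of_mem {p : M} (hp : p ∈ I.singularSet)
    (hκ : tractorMetric (I p) (I p) = 0) (x₀ : M) (hx : p ∈ (ch (d := d) x₀).source) (i : Fin d) :
    cpd i (inChart x₀ (I.sig g)) (ch x₀ p) = 0 := by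
  rw [tractorMetric_of_mem g hp] at hκ
  have h := (coInner_self_nonneg g.1 p _).2 hκ
  have hm : I.mu g p = 0 := covector_ext p (mem_extChartAt_source (I := 𝓡 d) p) fun i => h i
  rw [← hI.mu_frame g x₀ hx, hm]
  rfl

/-- For a null tractor every point of `Σ` is a critical point of `σ`, whereas `ρ ≠ 0` isolates the
critical point `p`. -/
lemma eventually_notMem_singularSet [PreconnectedSpace M]
    (hκ : ∀ x, tractorMetric (I x) (I x) = 0) {p : M} (hp : p ∈ I.singularSet) :
    ∀ᶠ q in 𝓝[≠] p, q ∉ I.singularSet := by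
  set g := c.someMetric
  have hps : p ∈ (ch (d := d) p).source := mem_extChartAt_source p
  have h0 : inChart p (I.sig g) (ch (d := d) p p) = 0 := by
    rw [inChart_apply _ _ hps]
    exact hp g
  have h1 := hI.cpd_sig_eq_zero_of_mem g hp (hκ p) p hps
  have hr : inChart p (I.rho g) (ch (d := d) p p) ≠ 0 := by
    intro hr
    refine hI.apply_ne_zero g p ((hI.comp_eq_zero_iff g p hps).2 ?_)
    rintro (_ | _ | i)
    exacts [h0, hr, h1 i]
  have h := (hI.parallelAt_self g p).eventually_cpd_ne (metricOn g.1 p) (ch_mem_target p)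
    (hI.smooth_sig g p _ (ch_mem_target p)) h0 h1 hr
  rw [eventually_nhdsWithin_iff] at h ⊢
  filter_upwards [(continuousAt_extChartAt (I := 𝓡 d) p).eventually h,
    (isOpen_ch_source (d := d) p).mem_nhds hps] with q hq hqs hqp hqS
  obtain ⟨i, hi⟩ := hq fun e => hqp ((ch (d := d) p).injOn hqs hps e)
  exact hi (hI.cpd_sig_eq_zero_of_mem g hqS (hκ q) p hqs i)

/-- `|dσ|² = |I|² > 0` on `Σ`, so some partial derivative is nonzero there and `σ` can serve as a
coordinate. -/
lemma isHypersurface_singularSet (hκ : ∀ p ∈ I.singularSet, 0 < tractorMetric (I p) (I p)) :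
    IsHypersurface d I.singularSet := by
  intro p hp
  set g := c.someMetric
  obtain ⟨i, hi⟩ : ∃ i, cpd i (inChart p (I.sig g)) (ch (d := d) p p) ≠ 0 := by
    by_contra! hc
    refine (hκ p hp).ne' ?_
    rw [tractorMetric_of_mem g hp, coInner]
    refine Finset.sum_eq_zero fun i _ => Finset.sum_eq_zero fun j _ => ?_
    rw [hI.mu_frame g p (mem_extChartAt_source p), hc, zero_mul, mul_zero]
  obtain ⟨e, he, hpe, hq⟩ := exists_chart_coord (hI.smooth g).1 p i hi
  refine ⟨e, he, hpe, i, fun q hqe => ?_⟩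
  rw [hq q hqe, mem_singularSet g]

variable {κ : ℝ} (hκ : ∀ x, tractorMetric (I x) (I x) = κ) (hpos : 0 < κ)
include hκ hpos

/-- The multiple `μ/|I|` is smooth everywhere, has unit length exactly because `|μ|² = κ` on `Σ`,
and annihilates tangent vectors since `μ = dσ`. -/
lemma isUnitConormalNear (p : M) :
    IsUnitConormalNear g.field I.singularSet (fun x => (Real.sqrt κ)⁻¹ • I.mu g x) p := by
  refine ⟨Eventually.of_forall fun q => ?_, Eventually.of_forall fun q hq => ⟨?_, fun v hv => ?_⟩⟩
  · exact ContMDiffAt.const_smul_section (a := (Real.sqrt κ)⁻¹) ((hI.smooth g).2.1 q)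
  · rw [coInner_smul_smul, ← tractorMetric_of_mem g hq, hκ, inv_pow, Real.sq_sqrt hpos.le,
      inv_mul_cancel₀ hpos.ne']
  · have h := sum_cpd_eq_zero_of_mem_tangentVectors (hI.smooth g).1
      (fun q hq => (mem_singularSet g q).1 hq) hv
    rw [← mul_zero (Real.sqrt κ)⁻¹, ← h, Finset.mul_sum]
    refine Finset.sum_congr rfl fun i _ => ?_
    rw [smul_apply, hI.mu_frame g q (mem_extChartAt_source q), smul_eq_mul]
    ring

lemma meanCurv_conormal (hd : 3 ≤ d) {p : M} (hp : p ∈ I.singularSet) :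
    meanCurv g.field (fun x => (Real.sqrt κ)⁻¹ • I.mu g x) p
      = - ((Real.sqrt κ)⁻¹ * I.rho g p) :=
  meanCurv_of_nablaForm_eq hd g.1 _ p _
    ((hI.isUnitConormalNear g hκ hpos p).2.self_of_nhds hp).1
    (hI.nablaForm_smul_mu_of_mem g _ hp)

/-- Along `Σ` the full derivative `∇ν`, not only its tangential part, is a multiple of `g`, and the
multiple is the mean curvature. -/
lemma isTotallyUmbilic_singularSet (hd : 3 ≤ d) : IsTotallyUmbilic g.field I.singularSet := by
  refine ⟨hI.isHypersurface_singularSet fun p _ => by rwa [hκ], fun p hp =>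
    ⟨_, hI.isUnitConormalNear g hκ hpos p, fun u _ v _ => ?_⟩⟩
  rw [hI.meanCurv_conormal g hκ hpos hd hp, secondFF, Finset.mul_sum]
  refine Finset.sum_congr rfl fun a _ => ?_
  rw [Finset.mul_sum]
  refine Finset.sum_congr rfl fun b _ => ?_
  rw [hI.nablaForm_smul_mu_of_mem g _ hp]
  ring

lemma isNormalTractorAlong_singularSet (hd : 3 ≤ d) :
    IsNormalTractorAlong (fun x => (Real.sqrt κ)⁻¹ • I x) I.singularSet := by
  refine fun g p _ => ⟨_, hI.isUnitConormalNear g hκ hpos p, Eventually.of_forall fun q hq => ?_⟩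
  rw [hI.meanCurv_conormal g hκ hpos hd hq, neg_neg]
  refine Prod.ext ?_ rfl
  change (Real.sqrt κ)⁻¹ * I.sig g q = 0
  rw [hq g, mul_zero]

end IsAlmostEinstein

end Global

end AlmostEinstein

end

/-! ### Assembly of the three cases. -/

theorem mainTheorem4 {d : ℕ} (hd : 3 ≤ d) {M : Type*} [TopologicalSpace M] [T2Space M]
    [SecondCountableTopology M] [ConnectedSpace M]
    [ChartedSpace (EuclideanSpace ℝ (Fin d)) M] [IsManifold (𝓡 d) ∞ M]
    (c : AlmostEinstein.ConformalStructure d M) (I : AlmostEinstein.TractorField c)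
    (hI : AlmostEinstein.IsAlmostEinstein I) :
    ∃ κ S : ℝ,
      -- `|I|²` and `S(I)` are constant
      (∀ x, AlmostEinstein.tractorMetric (I x) (I x) = κ) ∧
      (∀ (g : c.Metric) (x : M), AlmostEinstein.scaleCurv g.field (I.sig g) x = S) ∧
      -- the case `|I|² < 0`
      (κ < 0 ↔ 0 < S) ∧
      (κ < 0 → I.singularSet = ∅ ∧ ∀ g : c.Metric,
        AlmostEinstein.IsEinsteinOn (I.singularMetric g) univ ∧
        ∀ x, 0 < AlmostEinstein.scalarCurv (I.singularMetric g) x) ∧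
      -- the case `|I|² = 0`
      (κ = 0 ↔ S = 0) ∧
      (κ = 0 → (I.singularSet = ∅ ∨ ∀ p ∈ I.singularSet, ∀ᶠ q in 𝓝[≠] p, q ∉ I.singularSet) ∧
        ∀ g : c.Metric, AlmostEinstein.IsRicciFlatOn (I.singularMetric g) I.singularSetᶜ) ∧
      -- the case `|I|² > 0`
      (0 < κ ↔ S < 0) ∧
      (0 < κ → (I.singularSet = ∅ ∨
          ((∀ g : c.Metric, AlmostEinstein.IsTotallyUmbilic g.field I.singularSet) ∧
            AlmostEinstein.IsNormalTractorAlong (fun x => (Real.sqrt κ)⁻¹ • I x)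
              I.singularSet)) ∧
        ∀ g : c.Metric,
          AlmostEinstein.IsEinsteinOn (I.singularMetric g) I.singularSetᶜ ∧
          ∀ x ∈ I.singularSetᶜ, AlmostEinstein.scalarCurv (I.singularMetric g) x < 0) := by
  obtain ⟨κ, hκ⟩ := hI.exists_norm_eq
  have h3 : (3 : ℝ) ≤ d := by exact_mod_cast hd
  have hsc : ∀ g : c.Metric, ∀ x ∉ I.singularSet,
      AlmostEinstein.scalarCurv (I.singularMetric g) x = - (((d : ℝ) - 1) * d) * κ := by
    intro g x hx
    rw [hI.scalarCurv_singularMetric g hd hx, hκ]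
    ring
  have hein : ∀ g : c.Metric, ∀ x ∉ I.singularSet, ∀ i j,
      AlmostEinstein.ricci (I.singularMetric g) x i j
        = -((d : ℝ) - 1) * κ * AlmostEinstein.coeff (I.singularMetric g) x x i j := by
    intro g x hx i j
    rw [hI.ricci_singularMetric g hd hx, hκ]
  have hdd : 0 < ((d : ℝ) - 1) * d := mul_pos (by linarith) (by linarith)
  -- With `S = -κ` the three equivalences are trivial.
  refine ⟨κ, -κ, hκ, fun g x => by rw [hI.scaleCurv_eq g hd, hκ], by simp, fun h => ?_, by simp,
    fun h => ?_, by simp, fun h => ?_⟩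
  · have hS : I.singularSet = ∅ := by
      refine eq_empty_of_forall_notMem fun p hp => ?_
      have h1 := (AlmostEinstein.coInner_self_nonneg c.someMetric.1 p (I.mu c.someMetric p)).1
      rw [← AlmostEinstein.IsAlmostEinstein.tractorMetric_of_mem c.someMetric hp, hκ] at h1
      linarith
    have hn : ∀ x, x ∉ I.singularSet := fun x => by simp [hS]
    -- The Einstein constant, left to unification with `hein`, is `-(d-1)κ`.
    refine ⟨hS, fun g => ⟨⟨_, fun x _ => hein g x (hn x)⟩, fun x => ?_⟩⟩
    rw [hsc g x (hn x)]
    nlinarith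
  · subst h
    refine ⟨Or.inr fun p hp => hI.eventually_notMem_singularSet hκ hp, fun g x hx i j => ?_⟩
    -- For `κ = 0` the Einstein constant vanishes, which is Ricci-flatness.
    rw [hein g x hx, mul_zero, zero_mul]
  -- The second alternative also covers an empty `Σ`, for which its conditions are vacuous.
  · refine ⟨Or.inr ⟨fun g => hI.isTotallyUmbilic_singularSet g hκ h hd,
      hI.isNormalTractorAlong_singularSet hκ h hd⟩, fun g => ⟨⟨_, hein g⟩, fun x hx => ?_⟩⟩
    rw [hsc g x hx]
    nlinarith
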